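/- Multivariable Cauchy–Crofton Principle. Let $n\ge 1$ and $k\ge 0$ be integers. *Hypersurfaces.* For a unit vector $v\in S^{n-1}$ let $v^\perp$ be the hyperplane through the origin orthogonal to $v$. A compact smooth graph hypersurface in $\mathbb R^n$ is a set $\{\,y+g(y)v : y\in\overline D\,\}$, where $v\in S^{n-1}$, $D\subset v^\perp$ is bounded and open in $v^\perp$, and $g$ is a real function that is $C^\infty$ on a neighbourhood of $\overline D$ in $v^\perp$ (the boundary of $D$ may be smooth, piecewise smooth or arbitrary); its tangent hyperplane at $y+g(y)v$ is the image of the differential of $y\mapsto y+g(y)v$ at $y$. A compact smooth hypersurface $\Sigma\subset\mathbb R^n$ is a finite union of compact smooth graph hypersurfaces, and its tangent hyperplanes at a point are those of the graphs through that point. In particular, compact embedded $C^\infty$ hypersurfaces, with or without (piecewise) smooth boundary, are included. Let $\omega_\Sigma$ be the $(n-1)$-dimensional area measure on $\Sigma$ (the $(n-1)$-dimensional Hausdorff measure, normalized to agree with Lebesgue measure on $\mathbb R^{n-1}$). *Lines.* Let $\mathbf L^n=\{(v,p): v\in S^{n-1},\ p\in v^\perp\}$ be the space of oriented lines in $\mathbb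 R^n$, where $(v,p)$ stands for the line $\{tv+p: t\in\mathbb R\}$ oriented by $v$. Its kinematic measure $\mu$ is given by $$\int_{\mathbf L^n}h\,d\mu=\int_{S^{n-1}}d\sigma(v)\int_{v^\perp}h(v,p)\,dp ,$$ where $\sigma$ is the surface measure of $S^{n-1}$ and $dp$ is Lebesgue measure. A line $\ell=(v,p)$ is transverse to $\Sigma$ if at every point of $\ell\cap\Sigma$ the vector $v$ and each tangent hyperplane of $\Sigma$ at that point together span $\mathbb R^n$; then $\ell\cap\Sigma$ is finite. *Statement.* Let $f:\Sigma^k\to\mathbb R$ be continuous. Define $f^\Sigma:(\mathbf L^n)^k\to\mathbb R$ by $f^\Sigma(\ell_1,\dots,\ell_k)=0$ if some $\ell_i$ is not transverse to $\Sigma$, and otherwise $$f^\Sigma(\ell_1,\dots,\ell_k)=\sum f(x_1,\dots,x_k),$$ the sum being over all $k$-tuples with $x_i\in\ell_i\cap\Sigma$ for $i=1,\dots,k$. Let $\kappa_m$ denote the volume of the unit ball in $\mathbb R^m$. Then $f$ is integrable with respect to the product measure $\omega_\Sigma^{\otimes k}$, $f^\Sigma$ is integrable with respect to $\mu^{\otimes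 k}$, and $$\int_{\Sigma^k} f(x_1,\dots,x_k)\,d\omega_\Sigma(x_1)\cdots d\omega_\Sigma(x_k)=\left(\frac1{2\kappa_{n-1}}\right)^{k}\int_{(\mathbf L^n)^k} f^\Sigma(\ell_1,\dots,\ell_k)\,d\mu(\ell_1)\cdots d\mu(\ell_k).$$ -/

import Mathlib

open MeasureTheory
open scoped ContDiff

noncomputable section

namespace CauchyCrofton

/-- Euclidean `n`-space. -/
abbrev E (n : ℕ) : Type := EuclideanSpace ℝ (Fin n)

/-- The unit sphere of Euclidean `n`-space. -/
abbrev UnitSphere (n : ℕ) : Type := Metric.sphere (0 : E n) 1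

/-- The hyperplane through the origin orthogonal to `v`. -/
abbrev perp {n : ℕ} (v : UnitSphere n) : Submodule ℝ (E n) := (Submodule.span ℝ {(v : E n)})ᗮ

/-! ### Hypersurfaces -/

/-- A compact smooth graph hypersurface: the graph, in the direction of a unit vector `v`, over the
closure of a bounded open subset `D` of the hyperplane orthogonal to `v`, of a real function that
is smooth up to the boundary of `D`, i.e. on a neighbourhood of the closure of `D`.
The boundary of `D` may be smooth, piecewise smooth, or arbitrary. -/
structure GraphPiece (n : ℕ) where
  axis : UnitSphere n
  base : Set (perp axis)
  isOpen_base : IsOpen base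
  isBounded_base : Bornology.IsBounded base
  height : perp axis → ℝ
  smooth_height : ∃ U : Set (perp axis), IsOpen U ∧ closure base ⊆ U ∧ ContDiffOn ℝ ∞ height U

/-- The graph parametrization `y ↦ y + g(y) v`. -/
def GraphPiece.param {n : ℕ} (P : GraphPiece n) (y : perp P.axis) : E n :=
  (y : E n) + P.height y • (P.axis : E n)

/-- The graph as a subset of Euclidean space. -/
def GraphPiece.carrier {n : ℕ} (P : GraphPiece n) : Set (E n) :=
  P.param '' closure P.base

/-- The tangent hyperplane of the graph at the point over `y`. -/
def GraphPiece.tangentSpace {n : ℕ} (P : GraphPiece n) (y : perp P.axis) : Submodule ℝ (E n) :=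
  LinearMap.range (fderiv ℝ P.param y).toLinearMap

/-- A compact smooth hypersurface: a finite union of compact smooth graph hypersurfaces.
A compact set which is locally the graph of a smooth function over an open subset of some
hyperplane, or, at boundary points, over a closed region with smooth or piecewise smooth boundary,
is of this form, since it is covered by finitely many such graphs over smaller closed regions. -/
structure CompactHypersurface (n : ℕ) where
  numPieces : ℕ
  piece : Fin numPieces → GraphPiece n

/-- The hypersurface as a subset of Euclidean space. -/
def CompactHypersurface.carrier {n : ℕ} (S : CompactHypersurface n) : Set (E n) :=
  ⋃ i, (S.piece i).carrier

/-- The `(n - 1)`-dimensional area measure of the hypersurface. -/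
def CompactHypersurface.area {n : ℕ} (S : CompactHypersurface n) : Measure S.carrier :=
  (μHE[n - 1] : Measure (E n)).comap Subtype.val

/-! ### Oriented lines and the kinematic measure -/

/-- The space of oriented lines in Euclidean `n`-space: `(v, p)` with `‖v‖ = 1` and `p ⟂ v` is the
line through `p` in the direction `v`, and `p` is its point nearest to the origin. -/
abbrev OrientedLine (n : ℕ) : Type := {l : E n × E n // ‖l.1‖ = 1 ∧ inner ℝ l.1 l.2 = 0}

/-- The line with direction `v` through the point `p` orthogonal to `v`. -/
def lineMk {n : ℕ} (v : UnitSphere n) (p : perp v) : OrientedLine n :=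
  ⟨((v : E n), (p : E n)), by simp,
    Submodule.mem_orthogonal_singleton_iff_inner_right.1 p.2⟩

/-- The set of points of an oriented line. -/
def OrientedLine.points {n : ℕ} (l : OrientedLine n) : Set (E n) :=
  Set.range fun t : ℝ => t • l.1.1 + l.1.2

/-- The kinematic measure `∫ f dμ = ∫_{v ∈ S^{n-1}} ∫_{p ∈ v^⊥} f(v, p) dp dσ(v)`, where `σ` is the
surface measure of the sphere and `dp` is Lebesgue measure. -/
def kinematicMeasure (n : ℕ) : Measure (OrientedLine n) :=
  ((volume : Measure (E n)).toSphere).bind fun v => (volume : Measure (perp v)).map (lineMk v)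

theorem measurable_lineMk {n : ℕ} (v : UnitSphere n) : Measurable (lineMk v) := by
  apply Continuous.measurable
  unfold lineMk
  fun_prop

/-- The family of measures used in `kinematicMeasure` is measurable. -/
theorem measurable_kinematicFamily (n : ℕ) :
    Measurable fun v : UnitSphere n => (volume : Measure (perp v)).map (lineMk v) := by
  refine Measure.measurable_of_measurable_coe _ fun A hA => ?_
  -- compare with the volume of a cylinder of height `2` over the set in question
  let φ : UnitSphere n × E n → OrientedLine n := fun q =>
    ⟨((q.1 : E n), q.2 - inner ℝ (q.1 : E n) q.2 • (q.1 : E n)), by simp, by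
      have h : ‖(q.1 : E n)‖ = 1 := by simp
      simp [inner_sub_right, inner_smul_right, h]⟩
  have hφ : Measurable φ := by
    apply Continuous.measurable
    fun_prop
  have hT : MeasurableSet {q : UnitSphere n × E n | φ q ∈ A ∧
      inner ℝ (q.1 : E n) q.2 ∈ Set.Icc (-1 : ℝ) 1} := by
    refine (hφ hA).inter ?_
    have : Continuous fun q : UnitSphere n × E n => inner ℝ (q.1 : E n) q.2 := by fun_prop
    exact this.measurable measurableSet_Icc
  have key := measurable_measure_prodMk_left (ν := (volume : Measure (E n))) hT
  convert key.const_mul (2 : ENNReal)⁻¹ using 2 with v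
  have hv : ‖(v : E n)‖ = 1 := by simp
  rw [Measure.map_apply (measurable_lineMk v) hA]
  let s : Submodule ℝ (E n) := Submodule.span ℝ {(v : E n)}
  have hs : volume (Metric.closedBall (0 : s) 1) = 2 := by
    have e := LinearIsometryEquiv.toSpanUnitSingleton (𝕜 := ℝ) (v : E n) hv
    rw [← e.measurePreserving.measure_preimage measurableSet_closedBall.nullMeasurableSet,
      e.preimage_closedBall]
    simp
  have he : MeasurePreserving (s.measurableEquivProd (0 : E n)) volume volume := by
    have := s.measurePreserving_measurableEquivProd (0 : E n)
    rwa [InnerProductSpace.euclideanHausdorffMeasure_eq_volume] at this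
  have hpre : Prod.mk v ⁻¹' {q : UnitSphere n × E n | φ q ∈ A ∧
      inner ℝ (q.1 : E n) q.2 ∈ Set.Icc (-1 : ℝ) 1} =
      s.measurableEquivProd (0 : E n) ⁻¹'
        (Metric.closedBall (0 : s) 1 ×ˢ (lineMk v ⁻¹' A)) := by
    ext x
    have h1 : ((s.orthogonalProjectionOnto x : s) : E n) = inner ℝ (v : E n) x • (v : E n) :=
      Submodule.starProjection_unit_singleton ℝ hv x
    have h2 : ((sᗮ.orthogonalProjectionOnto x : sᗮ) : E n) =
        x - inner ℝ (v : E n) x • (v : E n) := by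
      rw [← Submodule.starProjection_unit_singleton ℝ hv x]
      exact Submodule.starProjection_orthogonal_val x
    have h3 : ‖s.orthogonalProjectionOnto x‖ = |inner ℝ (v : E n) x| := by
      change ‖((s.orthogonalProjectionOnto x : s) : E n)‖ = _
      rw [h1, norm_smul, hv, mul_one, Real.norm_eq_abs]
    have h4 : lineMk v (sᗮ.orthogonalProjectionOnto x) = φ (v, x) :=
      Subtype.ext (Prod.ext rfl h2)
    simp only [Set.mem_preimage, Set.mem_ofPred_eq, Submodule.measurableEquivProd_apply, vsub_eq_sub,
      sub_zero, Set.mem_prod, mem_closedBall_zero_iff, h3, h4, Set.mem_Icc, abs_le]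
    exact and_comm
  rw [hpre, he.measure_preimage_equiv, Measure.volume_eq_prod, Measure.prod_prod, hs, ← mul_assoc,
    ENNReal.inv_mul_cancel (by simp) (by simp), one_mul]

/-- The defining formula of the kinematic measure. -/
theorem kinematicMeasure_apply {n : ℕ} {A : Set (OrientedLine n)} (hA : MeasurableSet A) :
    kinematicMeasure n A =
      ∫⁻ v : UnitSphere n, volume {p : perp v | lineMk v p ∈ A} ∂(volume : Measure (E n)).toSphere := by
  rw [kinematicMeasure, Measure.bind_apply hA (measurable_kinematicFamily n).aemeasurable]
  refine lintegral_congr fun v => ?_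
  rw [Measure.map_apply (measurable_lineMk v) hA]
  rfl

/-! ### Transversality and the sum over intersection points -/

/-- The line `l` is transverse to the hypersurface: at every intersection point, its direction
and the tangent hyperplane there (each of them, if several sheets of the hypersurface meet at the
point) span the whole space. -/
def OrientedLine.IsTransverse {n : ℕ} (l : OrientedLine n) (S : CompactHypersurface n) : Prop :=
  ∀ i, ∀ y ∈ closure (S.piece i).base, (S.piece i).param y ∈ OrientedLine.points l →
    Submodule.span ℝ {l.1.1} ⊔ (S.piece i).tangentSpace y = ⊤

open Classical in
/-- The function `f^Σ(ℓ₁, …, ℓₖ)`: it is `0` if some `ℓᵢ` is not transverse to `Σ`, and otherwise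
the sum of `f(x₁, …, xₖ)` over all `k`-tuples with `xᵢ ∈ ℓᵢ ∩ Σ`. This is a finite sum, since a
line that is transverse to `Σ` meets it in finitely many points. -/
def lineSum {n : ℕ} (S : CompactHypersurface n) {k : ℕ} (f : (Fin k → S.carrier) → ℝ)
    (l : Fin k → OrientedLine n) : ℝ :=
  if ∀ i, OrientedLine.IsTransverse (l i) S then
    ∑ᶠ (x : Fin k → S.carrier) (_ : ∀ i, (x i : E n) ∈ OrientedLine.points (l i)), f x
  else 0

/-- The volume of the unit ball of Euclidean `m`-space. -/
def ballVolume (m : ℕ) : ℝ := volume.real (Metric.ball (0 : E m) 1)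

end CauchyCrofton

end

/-! The heart is the case of one line. Fix a direction `v` and project Σ along `v` onto `v^⊥`. By
the area formula, the number of points of `ℓ ∩ Σ` in a Borel set `B`, integrated over the lines of
direction `v`, is the integral over `Σ ∩ B` of |cos| of the angle between `v` and the normal.
Integrating over `v` replaces this factor by the mean of |⟨v, ν⟩| over the sphere, which does not
depend on ν and equals 2κ_{n-1}. Hence the kernel sending a line to the counting measure of its
intersection with Σ carries the kinematic measure to 2κ_{n-1} times area
(`bind_intersectionKernel`). For `k` lines one takes the product kernel (`bind_piKernel`); Fubini
for kernels then gives both the integrability of `lineSum` and the formula.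

On a graph `y ↦ y + g(y)a` everything is expressed by one linear form, `conormal`: its kernel is the
tangent hyperplane, its norm the area density, and its value at `v` the signed Jacobian of the
projection along `v` (`det_straightenDeriv`). The Hausdorff measure of a graph is found by
comparison with projections along normals, which are nearly isometric on small pieces. Tangent lines
are null because critical values are null.

Two decompositions make multiplicities harmless: `freshBase` assigns each point of Σ to a single
piece, and `sheet` cuts the transversal pairs (direction, point) into countably many sets on which
the line determines the pair. -/

noncomputable section

namespace CauchyCrofton

/-! ### Splitting space along an axis -/

section Axis

variable {n : ℕ} (a : UnitSphere n)

/-- The orthogonal projection onto the hyperplane orthogonal to `a`. -/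
def perpProj : E n →L[ℝ] perp a := (perp a).orthogonalProjectionOnto

theorem norm_axis : ‖(a : E n)‖ = 1 := by simp

theorem inner_axis_axis : inner ℝ (a : E n) (a : E n) = 1 := by
  rw [real_inner_self_eq_norm_sq, norm_axis, one_pow]

theorem inner_axis_perp (y : perp a) : inner ℝ (a : E n) (y : E n) = 0 :=
  Submodule.mem_orthogonal_singleton_iff_inner_right.1 y.2

theorem coe_perpProj (x : E n) :
    (perpProj a x : E n) = x - inner ℝ (a : E n) x • (a : E n) := by
  rw [← Submodule.starProjection_unit_singleton ℝ (norm_axis a) x]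
  exact Submodule.starProjection_orthogonal_val x

theorem perpProj_add_axis (x : E n) :
    (perpProj a x : E n) + inner ℝ (a : E n) x • (a : E n) = x := by
  rw [coe_perpProj, sub_add_cancel]

@[simp] theorem perpProj_axis : perpProj a (a : E n) = 0 := by
  apply Subtype.ext
  rw [coe_perpProj, inner_axis_axis]
  simp

@[simp] theorem perpProj_perp (y : perp a) : perpProj a (y : E n) = y := by
  apply Subtype.ext
  rw [coe_perpProj, inner_axis_perp]
  simp

/-- Space as the product of an axis and the hyperplane orthogonal to it. -/
def axialEquiv : E n ≃ᵐ ℝ × perp a :=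
  (Submodule.measurableEquivProd (Submodule.span ℝ {(a : E n)}) (0 : E n)).trans
    (MeasurableEquiv.prodCongr
      (LinearIsometryEquiv.toSpanUnitSingleton (𝕜 := ℝ) (a : E n)
        (norm_axis a)).symm.toHomeomorph.toMeasurableEquiv (MeasurableEquiv.refl _))

theorem axialEquiv_apply (x : E n) :
    axialEquiv a x = (inner ℝ (a : E n) x, perpProj a x) := by
  refine Prod.ext ?_ ?_
  · change (LinearIsometryEquiv.toSpanUnitSingleton (𝕜 := ℝ) (a : E n) (norm_axis a)).symm
      ((Submodule.measurableEquivProd (Submodule.span ℝ {(a : E n)}) (0 : E n)) x).1 = _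
    rw [LinearIsometryEquiv.symm_apply_eq]
    apply Subtype.ext
    simp only [Submodule.measurableEquivProd_apply, vsub_eq_sub, sub_zero]
    exact Submodule.starProjection_unit_singleton ℝ (norm_axis a) x
  · change ((Submodule.measurableEquivProd (Submodule.span ℝ {(a : E n)}) (0 : E n)) x).2 = _
    simp only [Submodule.measurableEquivProd_apply, vsub_eq_sub, sub_zero]
    rfl

theorem measurePreserving_axialEquiv : MeasurePreserving (axialEquiv a) volume volume := by
  have he := (Submodule.span ℝ {(a : E n)}).measurePreserving_measurableEquivProd (0 : E n)
  rw [InnerProductSpace.euclideanHausdorffMeasure_eq_volume] at he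
  refine MeasurePreserving.trans he ?_
  exact (LinearIsometryEquiv.toSpanUnitSingleton (𝕜 := ℝ) (a : E n)
    (norm_axis a)).symm.measurePreserving.prod (MeasurePreserving.id _)

/-- The cylinder of height one over a subset of the hyperplane orthogonal to `a`. -/
def unitCylinder (B : Set (perp a)) : Set (E n) :=
  {x | inner ℝ (a : E n) x ∈ Set.Icc (0 : ℝ) 1 ∧ perpProj a x ∈ B}

theorem unitCylinder_eq_preimage (B : Set (perp a)) :
    unitCylinder a B = axialEquiv a ⁻¹' (Set.Icc (0 : ℝ) 1 ×ˢ B) := by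
  ext x
  simp [unitCylinder, axialEquiv_apply]

theorem measurableSet_unitCylinder {B : Set (perp a)} (hB : MeasurableSet B) :
    MeasurableSet (unitCylinder a B) := by
  rw [unitCylinder_eq_preimage]
  exact (axialEquiv a).measurable (measurableSet_Icc.prod hB)

/-- Cylinders of height one turn a map between the different hyperplanes `a^⊥` and `v^⊥` into a
self-map of `E n`, where determinants and the change of variables formula apply. -/
theorem volume_unitCylinder (B : Set (perp a)) : volume (unitCylinder a B) = volume B := by
  rw [unitCylinder_eq_preimage, (measurePreserving_axialEquiv a).measure_preimage_equiv,
    Measure.volume_eq_prod, Measure.prod_prod]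
  simp

theorem setLIntegral_unitCylinder (B : Set (perp a)) {h : perp a → ENNReal} (hh : Measurable h) :
    ∫⁻ x in unitCylinder a B, h (perpProj a x) = ∫⁻ y in B, h y := by
  have h1 := (measurePreserving_axialEquiv a).setLIntegral_comp_preimage_emb
    (axialEquiv a).measurableEmbedding (fun q : ℝ × perp a => h q.2) (Set.Icc (0 : ℝ) 1 ×ˢ B)
  rw [← unitCylinder_eq_preimage] at h1
  simp only [axialEquiv_apply] at h1
  rw [h1, Measure.volume_eq_prod, ← Measure.prod_restrict,
    lintegral_prod (fun q : ℝ × perp a => h q.2) (hh.comp measurable_snd).aemeasurable]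
  simp

end Axis

/-! ### Graphs and their projections -/

section Graph

variable {n : ℕ} (a : UnitSphere n) (g : perp a → ℝ)

/-- The graph parametrization `y ↦ y + g(y) a`. -/
def graphMap (y : perp a) : E n := (y : E n) + g y • (a : E n)

/-- The linear form whose kernel is the tangent hyperplane of the graph and whose norm is the
area density. -/
def conormal (y : perp a) : E n →L[ℝ] ℝ :=
  innerSL ℝ (a : E n) - (fderiv ℝ g y).comp (perpProj a)

theorem conormal_apply (y : perp a) (x : E n) :
    conormal a g y x = inner ℝ (a : E n) x - fderiv ℝ g y (perpProj a x) := by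
  simp [conormal]

theorem conormal_axis (y : perp a) : conormal a g y (a : E n) = 1 := by
  rw [conormal_apply, inner_axis_axis, perpProj_axis, map_zero, sub_zero]

/-- The derivative of the graph parametrization. -/
def graphDeriv (y : perp a) : perp a →L[ℝ] E n :=
  (perp a).subtypeL + (fderiv ℝ g y).smulRight (a : E n)

theorem graphDeriv_apply (y w : perp a) :
    graphDeriv a g y w = (w : E n) + fderiv ℝ g y w • (a : E n) := by
  simp [graphDeriv]

theorem conormal_graphDeriv (y w : perp a) : conormal a g y (graphDeriv a g y w) = 0 := by
  rw [graphDeriv_apply, map_add, map_smul, conormal_axis, conormal_apply, inner_axis_perp,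
    perpProj_perp]
  simp

/-- Together with `conormal_graphDeriv`, this identifies the tangent hyperplane with the kernel of
the conormal. -/
theorem graphDeriv_perpProj_of_conormal_eq_zero (y : perp a) {x : E n}
    (hx : conormal a g y x = 0) : graphDeriv a g y (perpProj a x) = x := by
  rw [conormal_apply, sub_eq_zero] at hx
  rw [graphDeriv_apply, ← hx, perpProj_add_axis]

theorem perpProj_graphMap (y : perp a) : perpProj a (graphMap a g y) = y := by
  simp [graphMap]

theorem perpProj_graphDeriv (y w : perp a) : perpProj a (graphDeriv a g y w) = w := by
  simp [graphDeriv_apply]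

theorem graphMap_injective : Function.Injective (graphMap a g) :=
  Function.LeftInverse.injective (g := perpProj a) (perpProj_graphMap a g)

variable {g}

theorem hasStrictFDerivAt_graphMap (hg : ContDiff ℝ 1 g) (y : perp a) :
    HasStrictFDerivAt (graphMap a g) (graphDeriv a g y) y := by
  have h1 : HasStrictFDerivAt g (fderiv ℝ g y) y :=
    hg.contDiffAt.hasStrictFDerivAt one_ne_zero
  exact (perp a).subtypeL.hasStrictFDerivAt.add (h1.smul_const (a : E n))

theorem continuous_graphMap (hg : ContDiff ℝ 1 g) : Continuous (graphMap a g) := by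
  have := hg.continuous
  unfold graphMap
  fun_prop

theorem continuous_conormal (hg : ContDiff ℝ 1 g) : Continuous (conormal a g) := by
  have := hg.continuous_fderiv one_ne_zero
  unfold conormal
  fun_prop

/-! ### Projection of a graph along a direction. -/

variable (g)

/-- The map of space which sends the graph parametrization followed by projection along `v`,
times the axis, to the hyperplane orthogonal to `v`, times the line spanned by `v`. -/
def straighten (v : UnitSphere n) (x : E n) : E n :=
  (perpProj v (graphMap a g (perpProj a x)) : E n) + inner ℝ (a : E n) x • (v : E n)

/-- The derivative of `straighten`. -/
def straightenDeriv (v : UnitSphere n) (x : E n) : E n →L[ℝ] E n :=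
  (((perp v).subtypeL.comp (perpProj v)).comp
    ((graphDeriv a g (perpProj a x)).comp (perpProj a))) +
    (innerSL ℝ (a : E n)).smulRight (v : E n)

theorem hasFDerivAt_straighten {g : perp a → ℝ} (hg : ContDiff ℝ 1 g) (v : UnitSphere n)
    (x : E n) :
    HasFDerivAt (straighten a g v) (straightenDeriv a g v x) x := by
  have h1 : HasFDerivAt (fun x => graphMap a g (perpProj a x))
      ((graphDeriv a g (perpProj a x)).comp (perpProj a)) x :=
    (hasStrictFDerivAt_graphMap a hg _).hasFDerivAt.comp x (perpProj a).hasFDerivAt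
  have h2 := ((perp v).subtypeL.comp (perpProj v)).hasFDerivAt.comp x h1
  exact h2.add ((innerSL ℝ (a : E n)).hasFDerivAt.smul_const (v : E n))

/-- The derivative factors into three transvections. On `w + s a` with `w ⟂ a`, the first subtracts
`f3` from `s`, the second replaces `a` by `v'`, and the third restores the slope of the graph and
turns `v'` into `v`. The outer two have determinant one, so the middle one carries the whole
Jacobian. -/
theorem det_straightenDeriv (v : UnitSphere n) (x : E n) :
    (straightenDeriv a g v x).det = conormal a g (perpProj a x) v := by
  set y := perpProj a x
  let f1 : Module.Dual ℝ (E n) := ((fderiv ℝ g y).comp (perpProj a)).toLinearMap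
  let f2 : Module.Dual ℝ (E n) := (innerSL ℝ (a : E n)).toLinearMap
  let f3 : Module.Dual ℝ (E n) :=
    ((innerSL ℝ (v : E n)).comp ((graphDeriv a g y).comp (perpProj a))).toLinearMap
  let v' : E n := v - fderiv ℝ g y (perpProj a v) • (a : E n)
  have key : (straightenDeriv a g v x).toLinearMap =
      (LinearMap.transvection f1 (a : E n)).comp
        ((LinearMap.transvection f2 (v' - a)).comp (LinearMap.transvection f3 (-(a : E n)))) := by
    ext1 ξ
    have e1 : LinearMap.transvection f3 (-(a : E n)) ξ =
        perpProj a ξ + (inner ℝ (a : E n) ξ - f3 ξ) • (a : E n) := by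
      rw [LinearMap.transvection.apply]
      nth_rewrite 1 [← perpProj_add_axis a ξ]
      module
    have e2 : LinearMap.transvection f2 (v' - a) (LinearMap.transvection f3 (-(a : E n)) ξ) =
        perpProj a ξ + (inner ℝ (a : E n) ξ - f3 ξ) • v' := by
      have : f2 (perpProj a ξ + (inner ℝ (a : E n) ξ - f3 ξ) • (a : E n)) =
          inner ℝ (a : E n) ξ - f3 ξ := by
        rw [map_add, map_smul]
        change inner ℝ (a : E n) (perpProj a ξ : E n) + _ • inner ℝ (a : E n) (a : E n) = _
        rw [inner_axis_perp, inner_axis_axis]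
        simp
      rw [e1, LinearMap.transvection.apply, this]
      module
    have e3 : f1 ((perpProj a ξ : E n) + (inner ℝ (a : E n) ξ - f3 ξ) • v') =
        fderiv ℝ g y (perpProj a ξ) +
          (inner ℝ (a : E n) ξ - f3 ξ) * fderiv ℝ g y (perpProj a v) := by
      change fderiv ℝ g y (perpProj a _) = _
      simp [v']
    rw [LinearMap.comp_apply, LinearMap.comp_apply, e2, LinearMap.transvection.apply, e3]
    change (perpProj v (graphDeriv a g y (perpProj a ξ)) : E n) +
      inner ℝ (a : E n) ξ • (v : E n) = _
    have e4 : f3 ξ = inner ℝ (v : E n) (graphDeriv a g y (perpProj a ξ)) := rfl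
    rw [coe_perpProj, ← e4, graphDeriv_apply]
    simp only [v']
    module
  rw [ContinuousLinearMap.det, key, LinearMap.det_comp, LinearMap.det_comp,
    LinearMap.transvection.det, LinearMap.transvection.det, LinearMap.transvection.det]
  have d1 : f1 (a : E n) = 0 := by
    change fderiv ℝ g y (perpProj a _) = _
    simp
  have d3 : f3 (-(a : E n)) = 0 := by
    change inner ℝ (v : E n) (graphDeriv a g y (perpProj a (-(a : E n)))) = _
    simp
  have d2 : f2 (v' - a) = conormal a g y v - 1 := by
    change inner ℝ (a : E n) (v' - a) = _
    simp only [v', inner_sub_right, inner_smul_right, inner_axis_axis, conormal_apply]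
    ring
  rw [d1, d2, d3]
  ring

/-- The height along `a` becomes the height along `v` unchanged, so only the bases are transformed.
-/
theorem straighten_image_unitCylinder (v : UnitSphere n) (A : Set (perp a)) :
    straighten a g v '' unitCylinder a A =
      unitCylinder v ((fun y => perpProj v (graphMap a g y)) '' A) := by
  ext z
  constructor
  · rintro ⟨x, ⟨hx1, hx2⟩, rfl⟩
    refine ⟨?_, perpProj a x, hx2, ?_⟩
    · simpa [straighten, inner_add_right, inner_smul_right, inner_axis_perp] using hx1
    · simp [straighten]
  · rintro ⟨hz, y, hy, hyz⟩
    refine ⟨y + inner ℝ (v : E n) z • (a : E n), ⟨?_, ?_⟩, ?_⟩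
    · simpa [inner_add_right, inner_smul_right, inner_axis_perp] using hz
    · simpa using hy
    · have hyz' : perpProj v (graphMap a g y) = perpProj v z := hyz
      have h1 : perpProj a ((y : E n) + inner ℝ (v : E n) z • (a : E n)) = y := by simp
      have h2 : inner ℝ (a : E n) ((y : E n) + inner ℝ (v : E n) z • (a : E n)) =
          inner ℝ (v : E n) z := by
        simp [inner_add_right, inner_smul_right, inner_axis_perp]
      rw [straighten, h1, h2, hyz', perpProj_add_axis]

theorem injOn_straighten (v : UnitSphere n) {A : Set (perp a)}
    (hA : Set.InjOn (fun y => perpProj v (graphMap a g y)) A) :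
    Set.InjOn (straighten a g v) (unitCylinder a A) := by
  intro x hx x' hx' h
  have h1 : perpProj v (graphMap a g (perpProj a x)) =
      perpProj v (graphMap a g (perpProj a x')) := by
    have := congrArg (perpProj v) h
    simpa [straighten] using this
  have h2 : inner ℝ (a : E n) x = inner ℝ (a : E n) x' := by
    have := congrArg (fun z => inner ℝ (v : E n) z) h
    simpa [straighten, inner_add_right, inner_smul_right, inner_axis_perp] using this
  rw [← perpProj_add_axis a x, ← perpProj_add_axis a x', hA hx.2 hx'.2 h1, h2]

variable {g}

/-- The area of an injective projection of a piece of a graph. -/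
theorem volume_projection_graph (hg : ContDiff ℝ 1 g) (v : UnitSphere n) {A : Set (perp a)}
    (hA : MeasurableSet A) (hinj : Set.InjOn (fun y => perpProj v (graphMap a g y)) A) :
    volume ((fun y => perpProj v (graphMap a g y)) '' A) =
      ∫⁻ y in A, ENNReal.ofReal |conormal a g y v| := by
  have hm : Measurable fun y => ENNReal.ofReal |conormal a g y v| := by
    have := continuous_conormal a hg
    exact ENNReal.measurable_ofReal.comp (Continuous.measurable (by fun_prop))
  rw [← volume_unitCylinder, ← straighten_image_unitCylinder,
    ← lintegral_abs_det_fderiv_eq_addHaar_image volume (measurableSet_unitCylinder a hA)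
      (fun x _ => (hasFDerivAt_straighten a hg v x).hasFDerivWithinAt)
      (injOn_straighten a g v hinj), ← setLIntegral_unitCylinder a A hm]
  simp only [det_straightenDeriv]

/-- The critical values of a projection of a graph form a null set. -/
theorem volume_projection_graph_eq_zero (hg : ContDiff ℝ 1 g) (v : UnitSphere n)
    {A : Set (perp a)} (hA : ∀ y ∈ A, conormal a g y v = 0) :
    volume ((fun y => perpProj v (graphMap a g y)) '' A) = 0 := by
  rw [← volume_unitCylinder, ← straighten_image_unitCylinder]
  -- Sard's theorem in equal dimensions: C¹ is enough, and `A` need not be measurable.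
  refine addHaar_image_eq_zero_of_det_fderivWithin_eq_zero volume
    (fun x _ => (hasFDerivAt_straighten a hg v x).hasFDerivWithinAt) fun x hx => ?_
  rw [det_straightenDeriv]
  exact hA _ hx.2

end Graph

/-! ### Hausdorff measure of a graph -/

section Hausdorff

open scoped NNReal ENNReal

theorem euclideanHausdorffMeasure_image_le {X Y : Type*} [MetricSpace X] [MeasurableSpace X]
    [BorelSpace X] [MetricSpace Y] [MeasurableSpace Y] [BorelSpace Y] {K : ℝ≥0} {f : X → Y}
    {s : Set X} (h : LipschitzOnWith K f s) (d : ℕ) :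
    μHE[d] (f '' s) ≤ (K : ℝ≥0∞) ^ d * μHE[d] s := by
  have h1 := h.hausdorffMeasure_image_le (d := (d : ℝ)) (by positivity)
  rw [ENNReal.rpow_natCast] at h1
  simp only [Measure.euclideanHausdorffMeasure_def, Measure.smul_apply, ENNReal.smul_def,
    smul_eq_mul]
  rw [mul_left_comm]
  gcongr

/-- The bound makes any right inverse of `p` on `p '' s` `K`-Lipschitz, and forces `p` to be
injective on `s`, so the right inverse recovers all of `s`. -/
theorem euclideanHausdorffMeasure_le_image {X Y : Type*} [MetricSpace X] [MeasurableSpace X]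
    [BorelSpace X] [MetricSpace Y] [MeasurableSpace Y] [BorelSpace Y] {K : ℝ≥0} {p : X → Y}
    {s : Set X} (h : ∀ x ∈ s, ∀ x' ∈ s, dist x x' ≤ K * dist (p x) (p x')) (d : ℕ) :
    μHE[d] s ≤ (K : ℝ≥0∞) ^ d * μHE[d] (p '' s) := by
  rcases s.eq_empty_or_nonempty with rfl | ⟨x₀, -⟩
  · simp
  have : Nonempty X := ⟨x₀⟩
  have hmem : ∀ x ∈ s, Function.invFunOn p s (p x) ∈ s := fun x hx =>
    Function.invFunOn_mem ⟨x, hx, rfl⟩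
  have heq : ∀ x ∈ s, p (Function.invFunOn p s (p x)) = p x := fun x hx =>
    Function.invFunOn_eq (s := s) (f := p) ⟨x, hx, rfl⟩
  have hL : LipschitzOnWith K (Function.invFunOn p s) (p '' s) := by
    refine LipschitzOnWith.of_dist_le_mul ?_
    rintro _ ⟨x, hx, rfl⟩ _ ⟨x', hx', rfl⟩
    simpa only [heq x hx, heq x' hx'] using h _ (hmem x hx) _ (hmem x' hx')
  refine le_trans (measure_mono ?_) (euclideanHausdorffMeasure_image_le hL d)
  intro x hx
  refine ⟨p x, ⟨x, hx, rfl⟩, ?_⟩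
  have h1 := h _ (hmem x hx) x hx
  rw [heq x hx, dist_self, mul_zero] at h1
  exact dist_le_zero.1 h1

/-- By the Lindelöf property countably many of the neighbourhoods cover; making them disjoint lets
the local inequalities be summed. -/
theorem measure_le_mul_of_locally_le {X : Type*} [TopologicalSpace X] [SecondCountableTopology X]
    [MeasurableSpace X] [OpensMeasurableSpace X] {m₁ m₂ : Measure X} {C : ℝ≥0∞}
    (h : ∀ x, ∃ W ∈ nhds x, ∀ A ⊆ W, MeasurableSet A → m₁ A ≤ C * m₂ A) {A : Set X}
    (hA : MeasurableSet A) : m₁ A ≤ C * m₂ A := by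
  choose W hW hWle using h
  obtain ⟨t, ht, hcov⟩ := TopologicalSpace.countable_cover_nhds
    (f := fun x => interior (W x)) fun x => interior_mem_nhds.2 (hW x)
  rcases isEmpty_or_nonempty X with hX | ⟨⟨x₀⟩⟩
  · simp [Set.eq_empty_of_isEmpty A]
  have htne : t.Nonempty := by
    have hx : x₀ ∈ ⋃ x ∈ t, interior (W x) := hcov ▸ Set.mem_univ _
    obtain ⟨x, hx, -⟩ := Set.mem_iUnion₂.1 hx
    exact ⟨x, hx⟩
  obtain ⟨e, rfl⟩ := ht.exists_eq_range htne
  rw [Set.biUnion_range] at hcov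
  let s : ℕ → Set X := disjointed fun i => interior (W (e i))
  have hs : ∀ i, MeasurableSet (s i) := fun i =>
    MeasurableSet.disjointed (fun j => isOpen_interior.measurableSet) i
  have hd : Pairwise (Function.onFun Disjoint fun i => A ∩ s i) := fun i j hij =>
    (disjoint_disjointed _ hij).mono Set.inter_subset_right Set.inter_subset_right
  have hAs : A = ⋃ i, A ∩ s i := by
    rw [← Set.inter_iUnion, iUnion_disjointed, hcov, Set.inter_univ]
  rw [hAs, measure_iUnion hd fun i => hA.inter (hs i), measure_iUnion hd fun i => hA.inter (hs i),
    ← ENNReal.tsum_mul_left]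
  refine ENNReal.tsum_le_tsum fun i => hWle (e i) _ ?_ (hA.inter (hs i))
  exact Set.inter_subset_right.trans ((disjointed_subset _ i).trans interior_subset)

theorem le_of_forall_one_lt_le_pow_mul {x y : ℝ≥0∞} (d : ℕ)
    (h : ∀ K : ℝ≥0, 1 < K → x ≤ (K : ℝ≥0∞) ^ d * y) : x ≤ y := by
  have h1 : Filter.Tendsto (fun K : ℝ≥0 => (K : ℝ≥0∞) ^ d) (nhdsWithin 1 (Set.Ioi 1))
      (nhds 1) := by
    have h2 : Continuous fun K : ℝ≥0 => (K : ℝ≥0∞) ^ d := by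
      have : (fun K : ℝ≥0 => (K : ℝ≥0∞) ^ d) = fun K : ℝ≥0 => ((K ^ d : ℝ≥0) : ℝ≥0∞) := by
        ext K; simp
      rw [this]
      exact ENNReal.continuous_coe.comp (continuous_pow d)
    have h3 := (h2.tendsto 1).mono_left (nhdsWithin_le_nhds (s := Set.Ioi (1 : ℝ≥0)))
    simpa using h3
  -- The nonzero limit 1 keeps multiplication continuous even if `y = ⊤`.
  have h2 := ENNReal.Tendsto.mul_const (b := y) h1 (Or.inl one_ne_zero)
  rw [one_mul] at h2
  refine ge_of_tendsto h2 ?_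
  filter_upwards [self_mem_nhdsWithin] with K hK using h K hK

variable {n : ℕ}

theorem finrank_perp (v : UnitSphere n) : Module.finrank ℝ (perp v) = n - 1 := by
  have h1 := (Submodule.span ℝ {(v : E n)}).finrank_add_finrank_orthogonal
  have hv : (v : E n) ≠ 0 := fun h => by
    have := norm_axis v
    rw [h, norm_zero] at this
    exact zero_ne_one this
  rw [finrank_span_singleton hv, finrank_euclideanSpace_fin] at h1
  exact Nat.eq_sub_of_add_eq' h1

theorem euclideanHausdorffMeasure_perp (v : UnitSphere n) :
    (μHE[n - 1] : Measure (perp v)) = volume := by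
  rw [← finrank_perp v, InnerProductSpace.euclideanHausdorffMeasure_eq_volume]

theorem norm_perpProj_le (v : UnitSphere n) (x : E n) : ‖perpProj v x‖ ≤ ‖x‖ :=
  Submodule.norm_orthogonalProjectionOnto_apply_le _ x

theorem exists_unit_normal (η : E n →L[ℝ] ℝ) (hη : η ≠ 0) :
    ∃ ν : UnitSphere n, ∀ x, η x = ‖η‖ * inner ℝ (ν : E n) x := by
  let N : E n := (InnerProductSpace.toDual ℝ (E n)).symm η
  have hN : ‖N‖ = ‖η‖ := LinearIsometryEquiv.norm_map _ _
  have hpos : ‖η‖ ≠ 0 := norm_ne_zero_iff.2 hη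
  refine ⟨⟨‖η‖⁻¹ • N, ?_⟩, fun x => ?_⟩
  · rw [mem_sphere_zero_iff_norm, norm_smul, norm_inv, norm_norm, hN, inv_mul_cancel₀ hpos]
  · change η x = ‖η‖ * inner ℝ (‖η‖⁻¹ • N) x
    rw [real_inner_smul_left, mul_inv_cancel_left₀ hpos]
    exact (InnerProductSpace.toDual_symm_apply).symm

/-! ### Area of a graph by comparison with its projections. -/

variable (a : UnitSphere n) {g : perp a → ℝ}

theorem conormal_ne_zero (y : perp a) : conormal a g y ≠ 0 := fun h => by
  have := conormal_axis a g y
  rw [h] at this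
  exact zero_ne_one this

/-- Take ν normal to the graph at `y₀`. Chords near `y₀` are almost tangent, so they lose little
length when projected along ν. At `y₀` the conormal attains its norm at ν, and by continuity it
nearly does so nearby. -/
theorem exists_nhds_projection_expands (hg : ContDiff ℝ 1 g) (y₀ : perp a) {K : ℝ≥0}
    (hK : 1 < K) : ∃ ν : UnitSphere n, ∃ W ∈ nhds y₀,
      (∀ y ∈ W, ∀ y' ∈ W, dist (graphMap a g y) (graphMap a g y') ≤
        K * dist (perpProj ν (graphMap a g y)) (perpProj ν (graphMap a g y'))) ∧
      ∀ y ∈ W, ‖conormal a g y‖ₑ ≤ K * ‖conormal a g y ν‖ₑ := by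
  obtain ⟨ν, hν⟩ := exists_unit_normal _ (conormal_ne_zero a (g := g) y₀)
  have hpos : 0 < ‖conormal a g y₀‖ := norm_pos_iff.2 (conormal_ne_zero a y₀)
  have hK' : (1 : ℝ) < K := by exact_mod_cast hK
  have hδ : 0 < 1 - K⁻¹ := tsub_pos_of_lt (inv_lt_one_of_one_lt₀ hK)
  have hδ' : ((1 - K⁻¹ : ℝ≥0) : ℝ) = 1 - (K : ℝ)⁻¹ := by
    rw [NNReal.coe_sub (inv_lt_one_of_one_lt₀ hK).le]; simp
  -- With this error the ν-component of a chord `z` is at most `(1 - K⁻¹)‖z‖`, which leaves at least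
  -- `K⁻¹‖z‖` for its projection.
  obtain ⟨s, hs, hsA⟩ := (hasStrictFDerivAt_graphMap a hg y₀).approximates_deriv_on_nhds
    (c := 1 - K⁻¹) (Or.inr hδ)
  let V : Set (perp a) := {y | ‖conormal a g y‖ < K * |conormal a g y ν|}
  have hV : V ∈ nhds y₀ := by
    have hc := continuous_conormal a hg
    refine IsOpen.mem_nhds (isOpen_lt (by fun_prop) (by fun_prop)) ?_
    have h1 : conormal a g y₀ ν = ‖conormal a g y₀‖ := by rw [hν, inner_axis_axis, mul_one]
    change ‖conormal a g y₀‖ < K * |conormal a g y₀ ν|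
    rw [h1, abs_of_pos hpos]
    nlinarith
  refine ⟨ν, s ∩ V, Filter.inter_mem hs hV, ?_, ?_⟩
  · intro y hy y' hy'
    rw [dist_eq_norm, dist_eq_norm, ← map_sub]
    set z := graphMap a g y - graphMap a g y' with hz
    have hw : ‖y - y'‖ ≤ ‖z‖ := by
      have : perpProj a z = y - y' := by
        rw [hz, map_sub, perpProj_graphMap, perpProj_graphMap]
      rw [← this]
      exact norm_perpProj_le a z
    have h1 : ‖z - graphDeriv a g y₀ (y - y')‖ ≤ (1 - (K : ℝ)⁻¹) * ‖y - y'‖ := by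
      have := hsA y hy.1 y' hy'.1
      rwa [hδ'] at this
    have h2 : inner ℝ (ν : E n) (graphDeriv a g y₀ (y - y')) = 0 := by
      have := conormal_graphDeriv a g y₀ (y - y')
      rw [hν] at this
      exact (mul_eq_zero.1 this).resolve_left hpos.ne'
    have h3 : |inner ℝ (ν : E n) z| ≤ (1 - (K : ℝ)⁻¹) * ‖z‖ := by
      have h4 : inner ℝ (ν : E n) z = inner ℝ (ν : E n) (z - graphDeriv a g y₀ (y - y')) := by
        rw [inner_sub_right _ z, h2, sub_zero]
      rw [h4]
      refine (abs_real_inner_le_norm _ _).trans ?_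
      rw [norm_axis, one_mul]
      refine h1.trans (mul_le_mul_of_nonneg_left hw ?_)
      rw [← hδ']; positivity
    have h5 : ‖z‖ - |inner ℝ (ν : E n) z| ≤ ‖perpProj ν z‖ := by
      have := norm_sub_norm_le z (inner ℝ (ν : E n) z • (ν : E n))
      rw [norm_smul, norm_axis, mul_one, ← coe_perpProj] at this
      exact this
    have h6 : (K : ℝ)⁻¹ * ‖z‖ ≤ ‖perpProj ν z‖ := by linarith
    have hK0 : (0 : ℝ) < K := by linarith
    rwa [inv_mul_le_iff₀ hK0] at h6
  · intro y hy
    have h1 : ‖conormal a g y‖₊ ≤ K * ‖conormal a g y ν‖₊ := by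
      rw [← NNReal.coe_le_coe]
      push_cast
      exact (le_of_lt hy.2)
    rw [← ofReal_norm, ← ofReal_norm, ← coe_nnnorm, ← coe_nnnorm, ENNReal.ofReal_coe_nnreal,
      ENNReal.ofReal_coe_nnreal]
    exact_mod_cast h1

/-- The area of a piece of a graph. -/
theorem euclideanHausdorffMeasure_graphMap_image (hg : ContDiff ℝ 1 g)
    {A : Set (perp a)} (hA : MeasurableSet A) :
    μHE[n - 1] (graphMap a g '' A) = ∫⁻ y in A, ‖conormal a g y‖ₑ := by
  have hemb : MeasurableEmbedding (graphMap a g) :=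
    (continuous_graphMap a hg).measurableEmbedding (graphMap_injective a g)
  let m₁ : Measure (perp a) := (μHE[n - 1] : Measure (E n)).comap (graphMap a g)
  let m₂ : Measure (perp a) := volume.withDensity fun y => ‖conormal a g y‖ₑ
  have e₁ : ∀ B, m₁ B = μHE[n - 1] (graphMap a g '' B) := fun B => hemb.comap_apply _ _
  have e₂ : ∀ B, MeasurableSet B → m₂ B = ∫⁻ y in B, ‖conormal a g y‖ₑ := fun B hB =>
    withDensity_apply _ hB
  -- Both measures are compared with the volume of the projection along ν. The projection is
  -- 1-Lipschitz with `K`-Lipschitz inverse, which controls `m₁`; its density |η(ν)| lies between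
  -- ‖η‖/K and ‖η‖, which controls `m₂`. The exponent 1 only matches the form of
  -- `le_of_forall_one_lt_le_pow_mul`.
  have local_le : ∀ K : ℝ≥0, 1 < K → ∀ y₀ : perp a, ∃ W ∈ nhds y₀, ∀ B ⊆ W, MeasurableSet B →
      m₁ B ≤ (K : ℝ≥0∞) ^ (n - 1) * m₂ B ∧ m₂ B ≤ (K : ℝ≥0∞) ^ 1 * m₁ B := by
    intro K hK y₀
    obtain ⟨ν, W, hW, hexp, hcon⟩ := exists_nhds_projection_expands a hg y₀ hK
    refine ⟨W, hW, fun B hBW hB => ?_⟩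
    have himg : perpProj ν '' (graphMap a g '' B) =
        (fun y => perpProj ν (graphMap a g y)) '' B := Set.image_image _ _ _
    have hinj : Set.InjOn (fun y => perpProj ν (graphMap a g y)) B := by
      intro y hy y' hy' h
      have h1 := hexp y (hBW hy) y' (hBW hy')
      rw [show perpProj ν (graphMap a g y) = perpProj ν (graphMap a g y') from h, dist_self,
        mul_zero] at h1
      exact graphMap_injective a g (dist_le_zero.1 h1)
    have hvol := volume_projection_graph a hg ν hB hinj
    rw [← himg, ← euclideanHausdorffMeasure_perp ν] at hvol
    simp only [← Real.enorm_eq_ofReal_abs] at hvol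
    rw [e₁, e₂ B hB]
    constructor
    · refine (euclideanHausdorffMeasure_le_image (p := perpProj ν) (K := K) ?_ (n - 1)).trans ?_
      · rintro _ ⟨y, hy, rfl⟩ _ ⟨y', hy', rfl⟩
        exact hexp y (hBW hy) y' (hBW hy')
      · rw [hvol]
        gcongr with y
        have := (conormal a g y).le_opENorm ν
        rwa [← ofReal_norm (ν : E n), norm_axis, ENNReal.ofReal_one, mul_one] at this
    · have hL : LipschitzOnWith 1 (perpProj ν) (graphMap a g '' B) := by
        refine LipschitzOnWith.of_dist_le_mul fun x _ x' _ => ?_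
        rw [dist_eq_norm, dist_eq_norm, ← map_sub, NNReal.coe_one, one_mul]
        exact norm_perpProj_le ν _
      have h1 := euclideanHausdorffMeasure_image_le hL (n - 1)
      rw [hvol, ENNReal.coe_one, one_pow, one_mul] at h1
      rw [pow_one]
      refine le_trans ?_ (mul_le_mul_right h1 _)
      rw [← lintegral_const_mul' _ _ ENNReal.coe_ne_top]
      exact setLIntegral_mono' hB fun y hy => hcon y (hBW hy)
  rw [← e₁, ← e₂ A hA]
  refine le_antisymm ?_ ?_
  · refine le_of_forall_one_lt_le_pow_mul (n - 1) fun K hK => ?_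
    refine measure_le_mul_of_locally_le (fun y₀ => ?_) hA
    obtain ⟨W, hW, h⟩ := local_le K hK y₀
    exact ⟨W, hW, fun B hB hBm => (h B hB hBm).1⟩
  · refine le_of_forall_one_lt_le_pow_mul 1 fun K hK => ?_
    refine measure_le_mul_of_locally_le (fun y₀ => ?_) hA
    obtain ⟨W, hW, h⟩ := local_le K hK y₀
    exact ⟨W, hW, fun B hB hBm => (h B hB hBm).2⟩

end Hausdorff

/-! ### The mean of a linear form over the sphere -/

section SphereMean

open scoped ENNReal

theorem integral_mul_sqrt_one_sub_sq_pow (m : ℕ) :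
    ∫ t in (0 : ℝ)..1, t * √(1 - t ^ 2) ^ m = 1 / (m + 2) := by
  have hd : ∀ t ∈ Set.Ioo (0 : ℝ) 1,
      HasDerivAt (fun t : ℝ => -(√(1 - t ^ 2) ^ (m + 2) / (m + 2))) (t * √(1 - t ^ 2) ^ m) t := by
    intro t ht
    have hpos : 0 < 1 - t ^ 2 := by nlinarith [ht.1, ht.2]
    have h1 : HasDerivAt (fun t : ℝ => 1 - t ^ 2) (-(2 * t)) t := by
      simpa using (hasDerivAt_pow 2 t).const_sub 1
    have h2 := ((h1.sqrt hpos.ne').pow (m + 2)).div_const ((m : ℝ) + 2)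
    refine h2.neg.congr_deriv ?_
    have hs : √(1 - t ^ 2) ≠ 0 := (Real.sqrt_pos.2 hpos).ne'
    have hm : (m : ℝ) + 2 ≠ 0 := by positivity
    have : m + 2 - 1 = m + 1 := rfl
    rw [this, pow_succ]
    push_cast
    field_simp
  have hc : Continuous fun t : ℝ => -(√(1 - t ^ 2) ^ (m + 2) / (m + 2)) := by fun_prop
  have hc' : Continuous fun t : ℝ => t * √(1 - t ^ 2) ^ m := by fun_prop
  rw [intervalIntegral.integral_eq_sub_of_hasDerivAt_of_le zero_le_one hc.continuousOn hd
    (hc'.intervalIntegrable _ _)]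
  simp

theorem lintegral_enorm_mul_sqrt_one_sub_sq_pow (m : ℕ) :
    ∫⁻ t in Set.Ioo (-1 : ℝ) 1, ‖t‖ₑ * ENNReal.ofReal (√(1 - t ^ 2) ^ m) =
      ENNReal.ofReal (2 / (m + 2)) := by
  have hc : Continuous fun t : ℝ => |t| * √(1 - t ^ 2) ^ m := by fun_prop
  have h1 : ∀ t : ℝ, ‖t‖ₑ * ENNReal.ofReal (√(1 - t ^ 2) ^ m) =
      ENNReal.ofReal (|t| * √(1 - t ^ 2) ^ m) := fun t => by
    rw [Real.enorm_eq_ofReal_abs, ENNReal.ofReal_mul (abs_nonneg t)]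
  have hpos : ∫ t in (0 : ℝ)..1, |t| * √(1 - t ^ 2) ^ m = 1 / (m + 2) := by
    rw [← integral_mul_sqrt_one_sub_sq_pow]
    refine intervalIntegral.integral_congr fun t ht => ?_
    rw [Set.uIcc_of_le zero_le_one] at ht
    simp only [abs_of_nonneg ht.1]
  have hneg : ∫ t in (-1 : ℝ)..0, |t| * √(1 - t ^ 2) ^ m = 1 / (m + 2) := by
    rw [← hpos]
    have := intervalIntegral.integral_comp_neg (a := 0) (b := 1)
      fun t : ℝ => |t| * √(1 - t ^ 2) ^ m
    simpa using this.symm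
  simp only [h1]
  rw [← ofReal_integral_eq_lintegral_ofReal, ← integral_Ioc_eq_integral_Ioo,
    ← intervalIntegral.integral_of_le (by norm_num),
    ← intervalIntegral.integral_add_adjacent_intervals (b := 0) (hc.intervalIntegrable _ _)
      (hc.intervalIntegrable _ _), hpos, hneg]
  · congr 1
    ring
  · exact (hc.integrableOn_Icc (a := -1) (b := 1)).mono_set Set.Ioo_subset_Icc_self
  · exact Filter.Eventually.of_forall fun t => by positivity

variable {n : ℕ}

theorem volume_ball_perp (ν : UnitSphere n) :
    volume (Metric.ball (0 : perp ν) 1) = ENNReal.ofReal (ballVolume (n - 1)) := by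
  let b := (stdOrthonormalBasis ℝ (perp ν)).reindex (finCongr (finrank_perp ν))
  rw [ballVolume, Measure.real, ENNReal.ofReal_toReal measure_ball_lt_top.ne,
    ← b.measurePreserving_repr.measure_preimage measurableSet_ball.nullMeasurableSet,
    b.repr.preimage_ball, map_zero]

/-- Slice the ball orthogonally to ν: the slice at height `t` is a ball of radius √(1 - t²) in
dimension `n - 1`, and the integral over `t` is elementary. -/
theorem setLIntegral_ball_enorm_inner (hn : 1 ≤ n) (ν : UnitSphere n) :
    ∫⁻ x in Metric.ball (0 : E n) 1, ‖inner ℝ (ν : E n) x‖ₑ =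
      ENNReal.ofReal (ballVolume (n - 1)) * ENNReal.ofReal (2 / (n + 1)) := by
  let T : Set (ℝ × perp ν) := {q | q.1 ^ 2 + ‖q.2‖ ^ 2 < 1}
  have hT : MeasurableSet T := by
    refine (isOpen_lt ?_ ?_).measurableSet <;> fun_prop
  have hpre : axialEquiv ν ⁻¹' T = Metric.ball (0 : E n) 1 := by
    ext x
    rw [Set.mem_preimage, axialEquiv_apply, mem_ball_zero_iff]
    change inner ℝ (ν : E n) x ^ 2 + ‖perpProj ν x‖ ^ 2 < 1 ↔ _
    have h1 : ‖x‖ ^ 2 = inner ℝ (ν : E n) x ^ 2 + ‖perpProj ν x‖ ^ 2 := by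
      conv_lhs => rw [← perpProj_add_axis ν x]
      rw [norm_add_sq_real, real_inner_smul_right, real_inner_comm (ν : E n), inner_axis_perp,
        norm_smul,
        norm_axis, Submodule.coe_norm, Real.norm_eq_abs, mul_one, sq_abs]
      ring
    rw [← h1, sq_lt_one_iff₀ (norm_nonneg x)]
  have h1 := (measurePreserving_axialEquiv ν).setLIntegral_comp_preimage_emb
    (axialEquiv ν).measurableEmbedding (fun q : ℝ × perp ν => ‖q.1‖ₑ) T
  rw [hpre] at h1
  simp only [axialEquiv_apply] at h1
  have hslice : ∀ t : ℝ, Prod.mk t ⁻¹' T = Metric.ball (0 : perp ν) √(1 - t ^ 2) := by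
    intro t
    ext p
    rw [mem_ball_zero_iff, Real.lt_sqrt (norm_nonneg p)]
    change t ^ 2 + ‖p‖ ^ 2 < 1 ↔ _
    exact lt_sub_iff_add_lt'.symm
  -- The indicator is needed when `n = 1`: the exponent is then 0 and the power is 1 even for |t| ≥
  -- 1.
  have hvol : ∀ t : ℝ, volume (Prod.mk t ⁻¹' T) = (Set.Ioo (-1 : ℝ) 1).indicator
      (fun t => ENNReal.ofReal (√(1 - t ^ 2) ^ (n - 1))) t *
        ENNReal.ofReal (ballVolume (n - 1)) := by
    intro t
    rw [hslice]
    by_cases ht : t ∈ Set.Ioo (-1 : ℝ) 1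
    · have hpos : 0 < 1 - t ^ 2 := by nlinarith [ht.1, ht.2]
      rw [Measure.addHaar_ball_of_pos _ _ (Real.sqrt_pos.2 hpos), volume_ball_perp,
        Set.indicator_of_mem ht, finrank_perp]
    · have hneg : 1 - t ^ 2 ≤ 0 := by
        by_contra! h
        refine ht ?_
        rw [Set.mem_Ioo, ← abs_lt]
        exact (sq_lt_one_iff_abs_lt_one t).1 (by linarith)
      rw [Real.sqrt_eq_zero_of_nonpos hneg, Set.indicator_of_notMem ht, Metric.ball_zero,
        measure_empty, zero_mul]
  rw [h1, ← lintegral_indicator hT, Measure.volume_eq_prod,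
    lintegral_prod _ ((measurable_fst.enorm).indicator hT).aemeasurable]
  have hin : ∀ t : ℝ, ∫⁻ p : perp ν, T.indicator (fun q : ℝ × perp ν => ‖q.1‖ₑ) (t, p) =
      (Set.Ioo (-1 : ℝ) 1).indicator
        (fun t => ‖t‖ₑ * ENNReal.ofReal (√(1 - t ^ 2) ^ (n - 1))) t *
          ENNReal.ofReal (ballVolume (n - 1)) := by
    intro t
    have e1 : ∀ p : perp ν, T.indicator (fun q : ℝ × perp ν => ‖q.1‖ₑ) (t, p) =
        (Prod.mk t ⁻¹' T).indicator (fun _ => ‖t‖ₑ) p := fun p => rfl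
    simp only [e1]
    rw [lintegral_indicator_const (measurable_prodMk_left hT), hvol, ← mul_assoc]
    congr 1
    by_cases ht : t ∈ Set.Ioo (-1 : ℝ) 1
    · simp [Set.indicator_of_mem ht]
    · simp [Set.indicator_of_notMem ht]
  simp only [hin]
  rw [lintegral_mul_const' _ _ ENNReal.ofReal_ne_top, lintegral_indicator measurableSet_Ioo,
    lintegral_enorm_mul_sqrt_one_sub_sq_pow, mul_comm]
  congr 3
  push_cast [hn]
  ring

/-- The extra factor `r` raises the density `r^(n-1)` to `r^n`, whose mass on (0, 1) is known. -/
theorem lintegral_ofReal_indicator_volumeIoiPow (hn : 1 ≤ n) :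
    ∫⁻ r, (Set.Iio (⟨1, Set.mem_Ioi.2 one_pos⟩ : Set.Ioi (0 : ℝ))).indicator (fun r => ENNReal.ofReal r) r
      ∂(Measure.volumeIoiPow (n - 1)) = ENNReal.ofReal (1 / (n + 1)) := by
  have h1 := Measure.volumeIoiPow_apply_Iio n ⟨1, Set.mem_Ioi.2 one_pos⟩
  rw [one_pow] at h1
  rw [← h1, Measure.volumeIoiPow, Measure.volumeIoiPow, withDensity_apply _ measurableSet_Iio,
    lintegral_withDensity_eq_lintegral_mul _ (by fun_prop)
      ((by fun_prop : Measurable fun r : Set.Ioi (0 : ℝ) => ENNReal.ofReal r).indicator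
        measurableSet_Iio), ← lintegral_indicator measurableSet_Iio]
  refine lintegral_congr fun r => ?_
  by_cases hr : r ∈ Set.Iio (⟨1, Set.mem_Ioi.2 one_pos⟩ : Set.Ioi (0 : ℝ))
  · rw [Pi.mul_apply, Set.indicator_of_mem hr, Set.indicator_of_mem hr,
      ← ENNReal.ofReal_mul (pow_nonneg r.2.out.le _), ← pow_succ, Nat.sub_add_cancel hn]
  · rw [Pi.mul_apply, Set.indicator_of_notMem hr, Set.indicator_of_notMem hr, mul_zero]

/-- Polar coordinates: by homogeneity the integrand splits into a spherical and a radial factor. The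
mean over the sphere can thus be read off from the solid ball, where slicing is available. -/
theorem setLIntegral_ball_enorm_eq_toSphere (hn : 1 ≤ n) (η : E n →L[ℝ] ℝ) :
    ∫⁻ x in Metric.ball (0 : E n) 1, ‖η x‖ₑ =
      (∫⁻ v : UnitSphere n, ‖η v‖ₑ ∂(volume : Measure (E n)).toSphere) *
        ENNReal.ofReal (1 / (n + 1)) := by
  have : Nonempty (Fin n) := ⟨⟨0, hn⟩⟩
  have hp := (volume : Measure (E n)).measurePreserving_homeomorphUnitSphereProd
  rw [finrank_euclideanSpace_fin] at hp
  have hpunct : ∀ F : E n → ℝ≥0∞, ∫⁻ x, F x =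
      ∫⁻ x : ({0}ᶜ : Set (E n)), F x ∂(volume : Measure (E n)).comap Subtype.val := fun F => by
    rw [lintegral_subtype_comap (measurableSet_singleton _).compl, restrict_compl_singleton]
  have hrad : Measurable (Set.indicator (Set.Iio (⟨1, Set.mem_Ioi.2 one_pos⟩ : Set.Ioi (0 : ℝ)))
      fun r => ENNReal.ofReal r) :=
    (by fun_prop : Measurable fun r : Set.Ioi (0 : ℝ) => ENNReal.ofReal r).indicator
      measurableSet_Iio
  have hη : Measurable fun v : UnitSphere n => ‖η v‖ₑ := by fun_prop
  rw [← lintegral_ofReal_indicator_volumeIoiPow hn, ← lintegral_prod_mul hη.aemeasurable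
    hrad.aemeasurable, ← hp.lintegral_comp (by fun_prop), ← lintegral_indicator measurableSet_ball,
    hpunct]
  refine lintegral_congr fun x => ?_
  have hx : 0 < ‖(x : E n)‖ := norm_pos_iff.2 x.2
  rw [homeomorphUnitSphereProd_apply_fst_coe, map_smul]
  by_cases h : (x : E n) ∈ Metric.ball (0 : E n) 1
  · have h' : (homeomorphUnitSphereProd (E n) x).2 ∈
        Set.Iio (⟨1, Set.mem_Ioi.2 one_pos⟩ : Set.Ioi (0 : ℝ)) := by
      rw [Set.mem_Iio, ← Subtype.coe_lt_coe, homeomorphUnitSphereProd_apply_snd_coe]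
      exact mem_ball_zero_iff.1 h
    rw [Set.indicator_of_mem h, Set.indicator_of_mem h', homeomorphUnitSphereProd_apply_snd_coe,
      Real.enorm_eq_ofReal_abs, Real.enorm_eq_ofReal_abs, ← ENNReal.ofReal_mul (abs_nonneg _),
      smul_eq_mul, abs_mul, abs_of_pos (inv_pos.2 hx)]
    congr 1
    field_simp
  · have h' : (homeomorphUnitSphereProd (E n) x).2 ∉
        Set.Iio (⟨1, Set.mem_Ioi.2 one_pos⟩ : Set.Ioi (0 : ℝ)) := by
      rw [Set.mem_Iio, ← Subtype.coe_lt_coe, homeomorphUnitSphereProd_apply_snd_coe]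
      exact fun h2 => h (mem_ball_zero_iff.2 h2)
    rw [Set.indicator_of_notMem h, Set.indicator_of_notMem h', mul_zero]

/-- The integral over the sphere of the absolute value of a linear form. -/
theorem lintegral_toSphere_enorm (hn : 1 ≤ n) (η : E n →L[ℝ] ℝ) :
    ∫⁻ v : UnitSphere n, ‖η v‖ₑ ∂(volume : Measure (E n)).toSphere =
      ENNReal.ofReal (2 * ballVolume (n - 1)) * ‖η‖ₑ := by
  by_cases hη : η = 0
  · subst hη
    have h0 : ‖(0 : E n →L[ℝ] ℝ)‖ₑ = 0 := by rw [← ofReal_norm, norm_zero, ENNReal.ofReal_zero]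
    rw [h0, mul_zero]
    simp
  obtain ⟨ν, hν⟩ := exists_unit_normal η hη
  have h1 := setLIntegral_ball_enorm_eq_toSphere hn η
  have hn0 : (0 : ℝ) < 1 / (n + 1) := by positivity
  have hc : ENNReal.ofReal (1 / ((n : ℝ) + 1)) ≠ 0 := (ENNReal.ofReal_pos.2 hn0).ne'
  have hb : 0 ≤ ballVolume (n - 1) := measureReal_nonneg
  -- Compare the two evaluations of the ball integral and cancel the radial factor `1 / (n + 1)`.
  refine (ENNReal.mul_left_inj hc ENNReal.ofReal_ne_top).1 ?_
  rw [← h1]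
  simp only [hν, enorm_mul, enorm_norm]
  rw [lintegral_const_mul' _ _ enorm_ne_top, setLIntegral_ball_enorm_inner hn,
    ← ENNReal.ofReal_mul hb, mul_comm (ENNReal.ofReal (2 * _)), mul_assoc,
    ← ENNReal.ofReal_mul (by positivity)]
  congr 2
  ring

end SphereMean

/-! ### Products of kernels of finite measures -/

section ProductKernel

open scoped ENNReal
open ProbabilityTheory

theorem lintegral_pi_prod {α : Type*} [MeasurableSpace α] (μ : Measure α) [SigmaFinite μ]
    {k : ℕ} {h : Fin k → α → ℝ≥0∞} (hh : ∀ i, Measurable (h i)) :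
    ∫⁻ l, ∏ i, h i (l i) ∂(Measure.pi fun _ : Fin k => μ) = ∏ i, ∫⁻ x, h i x ∂μ := by
  induction k with
  | zero => simp
  | succ k ih =>
    have hp := measurePreserving_piFinSuccAbove (fun _ : Fin (k + 1) => μ) 0
    have hprod : Measurable fun l : Fin k → α => ∏ i : Fin k, h i.succ (l i) :=
      Finset.measurable_prod _ fun i _ => (hh i.succ).comp (measurable_pi_apply i)
    have hm : Measurable fun q : α × (Fin k → α) => h 0 q.1 * ∏ i : Fin k, h i.succ (q.2 i) :=
      ((hh 0).comp measurable_fst).mul (hprod.comp measurable_snd)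
    rw [Fin.prod_univ_succ, ← ih fun i => hh i.succ,
      ← lintegral_prod_mul (hh 0).aemeasurable hprod.aemeasurable]
    refine Eq.trans (lintegral_congr fun l => ?_) (hp.lintegral_comp hm)
    rw [Fin.prod_univ_succ]
    rfl

variable {α β : Type*} [MeasurableSpace α] [MeasurableSpace β]

/-- The product of copies of a kernel of finite measures. -/
def piKernel (κ : Kernel α β) [∀ x, IsFiniteMeasure (κ x)] (k : ℕ) :
    Kernel (Fin k → α) (Fin k → β) where
  toFun l := Measure.pi fun i => κ (l i)
  measurable' := by
    refine Measurable.measure_of_isPiSystem generateFrom_pi.symm isPiSystem_pi ?_ ?_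
    · rintro _ ⟨s, hs, rfl⟩
      simp only [Measure.pi_pi]
      exact Finset.measurable_prod _ fun i _ =>
        (κ.measurable_coe (hs i (Set.mem_univ i))).comp (measurable_pi_apply i)
    · simp only [Measure.pi_univ]
      exact Finset.measurable_prod _ fun i _ =>
        (κ.measurable_coe MeasurableSet.univ).comp (measurable_pi_apply i)

theorem piKernel_apply (κ : Kernel α β) [∀ x, IsFiniteMeasure (κ x)] {k : ℕ} (l : Fin k → α) :
    piKernel κ k l = Measure.pi fun i => κ (l i) := rfl

/-- On boxes the integrand is a product of functions of separate variables, so the integral factors.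
This carries the one-line formula to `k` lines. -/
theorem bind_piKernel (μ : Measure α) [SigmaFinite μ] (κ : Kernel α β)
    [∀ x, IsFiniteMeasure (κ x)] [SigmaFinite (μ.bind κ)] (k : ℕ) :
    (Measure.pi fun _ : Fin k => μ).bind (piKernel κ k) =
      Measure.pi fun _ : Fin k => μ.bind κ := by
  symm
  refine Measure.pi_eq fun s hs => ?_
  rw [Measure.bind_apply (MeasurableSet.univ_pi hs) (piKernel κ k).measurable.aemeasurable]
  simp only [piKernel_apply, Measure.pi_pi]
  rw [lintegral_pi_prod μ fun i => κ.measurable_coe (hs i)]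
  exact Finset.prod_congr rfl fun i _ =>
    (Measure.bind_apply (hs i) κ.measurable.aemeasurable).symm

/-- Viewing μ as a constant kernel on a point makes this Fubini for a composition of kernels. -/
theorem integral_bind_kernel (μ : Measure α) (κ : Kernel α β) {f : β → ℝ}
    (hf : Integrable f (μ.bind κ)) :
    Integrable (fun x => ∫ y, f y ∂(κ x)) μ ∧
      ∫ y, f y ∂(μ.bind κ) = ∫ x, ∫ y, f y ∂(κ x) ∂μ := by
  have e : (κ ∘ₖ Kernel.const Unit μ) () = μ.bind κ := by
    rw [Kernel.comp_apply, Kernel.const_apply]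
  rw [← e] at hf ⊢
  refine ⟨?_, ?_⟩
  · simpa using hf.integral_comp
  · rw [Kernel.integral_comp hf, Kernel.const_apply]

/-- On a box this is the expansion of a product of sums into a sum over tuples. -/
theorem pi_sum_dirac {k : ℕ} (F : Fin k → Finset β) :
    (Measure.pi fun i => ∑ x ∈ F i, Measure.dirac x) =
      ∑ x ∈ Fintype.piFinset F, Measure.dirac x := by
  refine Measure.pi_eq fun s hs => ?_
  simp only [Measure.coe_finsetSum, Finset.sum_apply]
  rw [Finset.prod_univ_sum]
  refine Finset.sum_congr rfl fun x _ => ?_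
  rw [Measure.dirac_apply' _ (MeasurableSet.univ_pi hs)]
  simp only [fun i => Measure.dirac_apply' (x i) (hs i)]
  by_cases hx : ∀ i, x i ∈ s i
  · rw [Set.indicator_of_mem (Set.mem_univ_pi.2 hx)]
    exact (Finset.prod_eq_one fun i _ => Set.indicator_of_mem (hx i) _).symm
  · rw [Set.indicator_of_notMem fun h => hx (Set.mem_univ_pi.1 h)]
    obtain ⟨i, hi⟩ := not_forall.1 hx
    exact (Finset.prod_eq_zero (Finset.mem_univ i) (Set.indicator_of_notMem hi _)).symm

theorem integral_pi_sum_dirac [MeasurableSingletonClass β] {k : ℕ} (F : Fin k → Finset β)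
    (f : (Fin k → β) → ℝ) :
    ∫ x, f x ∂(Measure.pi fun i => ∑ x ∈ F i, Measure.dirac x) =
      ∑ᶠ (x : Fin k → β) (_ : ∀ i, x i ∈ F i), f x := by
  rw [pi_sum_dirac, integral_finsetSum_measure fun x _ => integrable_dirac (by simp)]
  simp only [integral_dirac]
  rw [← finsum_mem_coe_finset]
  simp

end ProductKernel

/-! ### Lines through points of a graph -/

section Lines

open scoped ENNReal

variable {n : ℕ}

/-- The direction of an oriented line. -/
def OrientedLine.dir (l : OrientedLine n) : UnitSphere n :=
  ⟨l.1.1, mem_sphere_zero_iff_norm.2 l.2.1⟩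

/-- The oriented line with direction `v` through the point `x`. -/
def lineThrough (v : UnitSphere n) (x : E n) : OrientedLine n := lineMk v (perpProj v x)

theorem lineMk_injective (v : UnitSphere n) : Function.Injective (lineMk v) := fun _ _ h =>
  Subtype.ext (congrArg (fun l : OrientedLine n => l.1.2) h)

theorem lineThrough_eq_iff {v w : UnitSphere n} {x y : E n} :
    lineThrough v x = lineThrough w y ↔ v = w ∧ perpProj v x = perpProj v y := by
  constructor
  · intro h
    have hvw : v = w := congrArg OrientedLine.dir h
    subst hvw
    exact ⟨rfl, lineMk_injective v h⟩
  · rintro ⟨rfl, h⟩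
    rw [lineThrough, lineThrough, h]

theorem continuous_lineThrough : Continuous fun q : UnitSphere n × E n => lineThrough q.1 q.2 := by
  refine Continuous.subtype_mk (Continuous.prodMk (by fun_prop) ?_) _
  simp only [coe_perpProj]
  fun_prop

theorem mem_points_iff (l : OrientedLine n) (x : E n) :
    x ∈ OrientedLine.points l ↔ lineThrough l.dir x = l := by
  have hl : inner ℝ (l.dir : E n) l.1.2 = 0 := l.2.2
  constructor
  · rintro ⟨t, rfl⟩
    refine Subtype.ext (Prod.ext rfl ?_)
    change (perpProj l.dir (t • (l.dir : E n) + l.1.2) : E n) = l.1.2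
    rw [map_add, map_smul, perpProj_axis, smul_zero, zero_add, coe_perpProj, hl, zero_smul,
      sub_zero]
  · intro h
    refine ⟨inner ℝ (l.dir : E n) x, ?_⟩
    have h2 : l.1.2 = (perpProj l.dir x : E n) :=
      congrArg (fun l : OrientedLine n => l.1.2) h.symm
    change inner ℝ (l.dir : E n) x • (l.dir : E n) + l.1.2 = x
    rw [h2, add_comm, perpProj_add_axis]

/-- Lines within distance `R` of the origin have finite measure: the unit cylinder over an `R`-ball
lies in a ball of radius `1 + R`, a bound uniform in the direction. -/
instance : SigmaFinite (kinematicMeasure n) := by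
  let s : ℕ → Set (OrientedLine n) := fun R => {l | ‖l.1.2‖ ≤ R}
  have hs : ∀ R, MeasurableSet (s R) := fun R => by
    refine (isClosed_le ?_ ?_).measurableSet <;> fun_prop
  refine ⟨⟨{ set := s, set_mem := fun _ => trivial, finite := fun R => ?_, spanning := ?_ }⟩⟩
  · rw [kinematicMeasure_apply (hs R)]
    calc ∫⁻ v : UnitSphere n, volume {p : perp v | lineMk v p ∈ s R}
          ∂(volume : Measure (E n)).toSphere
        ≤ ∫⁻ _ : UnitSphere n, volume (Metric.closedBall (0 : E n) (1 + R))
          ∂(volume : Measure (E n)).toSphere := by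
          refine lintegral_mono fun v => ?_
          rw [← volume_unitCylinder]
          refine measure_mono fun x hx => ?_
          obtain ⟨⟨h0, h1⟩, h2⟩ := hx
          have h3 : ‖(perpProj v x : E n)‖ ≤ R := h2
          rw [mem_closedBall_zero_iff, ← perpProj_add_axis v x]
          refine (norm_add_le _ _).trans ?_
          rw [norm_smul, norm_axis, mul_one, Real.norm_eq_abs, abs_of_nonneg h0]
          linarith
      _ < ⊤ := by
          rw [lintegral_const]
          exact ENNReal.mul_lt_top measure_closedBall_lt_top (measure_lt_top _ _)
  · refine Set.eq_univ_of_forall fun l => Set.mem_iUnion.2 ?_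
    exact exists_nat_ge ‖l.1.2‖

/-! ### Kinematic measure of the lines meeting a graph. -/

variable (a : UnitSphere n) {g : perp a → ℝ}

variable (g) in
/-- The line in direction `v` through the point of the graph over `y`. -/
def graphLine (q : UnitSphere n × perp a) : OrientedLine n := lineThrough q.1 (graphMap a g q.2)

theorem continuous_graphLine (hg : ContDiff ℝ 1 g) : Continuous (graphLine a g) :=
  continuous_lineThrough.comp
    (continuous_fst.prodMk ((continuous_graphMap a hg).comp continuous_snd))

theorem lineMk_mem_graphLine_image (v : UnitSphere n) (A : Set (UnitSphere n × perp a)) :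
    {p : perp v | lineMk v p ∈ graphLine a g '' A} =
      (fun y => perpProj v (graphMap a g y)) '' {y | (v, y) ∈ A} := by
  ext p
  constructor
  · rintro ⟨⟨w, y⟩, hA, h⟩
    have hvw : w = v := congrArg OrientedLine.dir h
    subst hvw
    exact ⟨y, hA, lineMk_injective w h⟩
  · rintro ⟨y, hy, rfl⟩
    exact ⟨(v, y), hy, rfl⟩

theorem continuous_conormal_apply (hg : ContDiff ℝ 1 g) :
    Continuous fun q : UnitSphere n × perp a => conormal a g q.2 q.1 := by
  have := continuous_conormal a hg
  fun_prop

/-- The kinematic measure of the lines that are tangent to a graph. -/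
theorem kinematicMeasure_graphLine_image_eq_zero (hg : ContDiff ℝ 1 g)
    {A : Set (UnitSphere n × perp a)} (hA : ∀ q ∈ A, conormal a g q.2 q.1 = 0)
    (hm : MeasurableSet (graphLine a g '' A)) :
    kinematicMeasure n (graphLine a g '' A) = 0 := by
  rw [kinematicMeasure_apply hm]
  simp only [lineMk_mem_graphLine_image]
  refine (lintegral_congr fun v => ?_).trans lintegral_zero
  exact volume_projection_graph_eq_zero a hg v fun y hy => hA _ hy

/-- The kinematic measure of a set of lines meeting a graph, each with a marked intersection
point. -/
theorem kinematicMeasure_graphLine_image (hg : ContDiff ℝ 1 g) {A : Set (UnitSphere n × perp a)}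
    (hA : MeasurableSet A) (hinj : Set.InjOn (graphLine a g) A) :
    kinematicMeasure n (graphLine a g '' A) =
      ∫⁻ q in A, ‖conormal a g q.2 q.1‖ₑ ∂((volume : Measure (E n)).toSphere.prod volume) := by
  have hm : MeasurableSet (graphLine a g '' A) :=
    hA.image_of_continuousOn_injOn (continuous_graphLine a hg).continuousOn hinj
  have hc : Measurable fun q : UnitSphere n × perp a => ‖conormal a g q.2 q.1‖ₑ :=
    (continuous_conormal_apply a hg).measurable.enorm
  rw [kinematicMeasure_apply hm, ← lintegral_indicator hA,
    lintegral_prod _ (hc.indicator hA).aemeasurable]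
  refine lintegral_congr fun v => ?_
  have hAv : MeasurableSet {y | (v, y) ∈ A} := measurable_prodMk_left hA
  have e : ∀ y, A.indicator (fun q => ‖conormal a g q.2 q.1‖ₑ) (v, y) =
      {y | (v, y) ∈ A}.indicator (fun y => ‖conormal a g y v‖ₑ) y := fun y => rfl
  simp only [e]
  rw [lineMk_mem_graphLine_image, lintegral_indicator hAv, volume_projection_graph a hg v hAv]
  · simp only [Real.enorm_eq_ofReal_abs]
  · intro y hy y' hy' h
    have := hinj hy hy' (lineThrough_eq_iff.2 ⟨rfl, h⟩)
    exact congrArg Prod.snd this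

/-- Near a transversal intersection, a line determines its intersection point with the graph. -/
theorem exists_nhds_injOn_graphLine (hg : ContDiff ℝ 1 g) {v₀ : UnitSphere n} {y₀ : perp a}
    (h₀ : conormal a g y₀ v₀ ≠ 0) :
    ∃ W ∈ nhds (v₀, y₀), Set.InjOn (graphLine a g) W := by
  -- Two points on a line of direction `v` have chord `t v`, so `L` is small on `(y - y', t)` when
  -- `v` is near `v₀`. Since `v₀` is not tangent, `L` is injective, hence bounded below.
  let L : perp a × ℝ →ₗ[ℝ] E n :=
    (graphDeriv a g y₀).toLinearMap.coprod (LinearMap.toSpanSingleton ℝ (E n) (-(v₀ : E n)))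
  have hL : ∀ w t, L (w, t) = graphDeriv a g y₀ w - t • (v₀ : E n) := fun w t => by
    simp [L, sub_eq_add_neg]
  have hker : L.ker = ⊥ := by
    rw [LinearMap.ker_eq_bot']
    rintro ⟨w, t⟩ h
    rw [hL] at h
    have h1 := congrArg (conormal a g y₀) h
    rw [map_sub, conormal_graphDeriv, map_smul, map_zero, zero_sub, neg_eq_zero, smul_eq_mul] at h1
    have ht : t = 0 := (mul_eq_zero.1 h1).resolve_right h₀
    rw [ht, zero_smul, sub_zero] at h
    have h2 := congrArg (perpProj a) h
    rw [perpProj_graphDeriv, map_zero] at h2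
    rw [h2, ht]
    rfl
  obtain ⟨K, hK, hLK⟩ := L.exists_antilipschitzWith hker
  have hKr : (0 : ℝ) < K := hK
  -- There are two errors, from moving the direction and from linearizing the graph. A third of
  -- `K⁻¹` for each gives `N ≤ 2/3 * N`.
  have hε : 0 < K⁻¹ / 3 := by positivity
  obtain ⟨s, hs, hsA⟩ := (hasStrictFDerivAt_graphMap a hg y₀).approximates_deriv_on_nhds
    (c := K⁻¹ / 3) (Or.inr hε)
  refine ⟨Metric.ball v₀ (K⁻¹ / 3 : NNReal) ×ˢ s,
    prod_mem_nhds (Metric.ball_mem_nhds _ (NNReal.coe_pos.2 hε)) hs, ?_⟩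
  rintro ⟨v, y⟩ ⟨hv, hy⟩ ⟨v', y'⟩ ⟨-, hy'⟩ h
  obtain ⟨rfl, h1⟩ := lineThrough_eq_iff.1 h
  refine Prod.ext rfl ?_
  change y = y'
  change v ∈ _ at hv
  change y ∈ s at hy
  change y' ∈ s at hy'
  set z := graphMap a g y - graphMap a g y' with hz
  set t := inner ℝ (v : E n) z
  have hzt : z = t • (v : E n) := by
    have h2 : perpProj v z = 0 := by
      rw [hz, map_sub, sub_eq_zero]
      exact h1
    have h3 := perpProj_add_axis v z
    rw [h2, Submodule.coe_zero, zero_add] at h3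
    exact h3.symm
  have h4 : ‖z - graphDeriv a g y₀ (y - y')‖ ≤ (K : ℝ)⁻¹ / 3 * ‖y - y'‖ := hsA y hy y' hy'
  have h5 : ‖(v : E n) - v₀‖ ≤ (K : ℝ)⁻¹ / 3 := by
    rw [← dist_eq_norm]
    exact (Metric.mem_ball.1 hv).le
  have h6 : L (y - y', t) = t • ((v : E n) - v₀) - (z - graphDeriv a g y₀ (y - y')) := by
    rw [hL, smul_sub, ← hzt]
    abel
  have h7 : ‖((y - y', t) : perp a × ℝ)‖ ≤ K * ‖L (y - y', t)‖ := by
    have := hLK.le_mul_dist (y - y', t) 0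
    rwa [map_zero, dist_zero_right, dist_zero_right] at this
  have h8 : ‖y - y'‖ ≤ ‖((y - y', t) : perp a × ℝ)‖ := norm_fst_le ((y - y', t) : perp a × ℝ)
  have h9 : ‖t‖ ≤ ‖((y - y', t) : perp a × ℝ)‖ := norm_snd_le ((y - y', t) : perp a × ℝ)
  set N := ‖((y - y', t) : perp a × ℝ)‖
  have hKi : 0 < (K : ℝ)⁻¹ / 3 := by positivity
  have h10 : ‖L (y - y', t)‖ ≤ (K : ℝ)⁻¹ / 3 * N + (K : ℝ)⁻¹ / 3 * N := by
    rw [h6]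
    refine (norm_sub_le _ _).trans (add_le_add ?_ ?_)
    · rw [norm_smul, mul_comm]
      exact mul_le_mul h5 h9 (norm_nonneg _) hKi.le
    · exact h4.trans (mul_le_mul_of_nonneg_left h8 hKi.le)
  have h11 : N ≤ 2 / 3 * N := by
    calc N ≤ K * ‖L (y - y', t)‖ := h7
      _ ≤ K * ((K : ℝ)⁻¹ / 3 * N + (K : ℝ)⁻¹ / 3 * N) := by gcongr
      _ = 2 / 3 * N := by field_simp; ring
  have h12 : ‖y - y'‖ ≤ 0 := by linarith
  exact sub_eq_zero.1 (norm_le_zero_iff.1 h12)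

theorem exists_countable_injOn_decomposition {X Y : Type*} [TopologicalSpace X]
    [SecondCountableTopology X] [MeasurableSpace X] [OpensMeasurableSpace X] {f : X → Y}
    {O : Set X} (hO : MeasurableSet O) (h : ∀ x ∈ O, ∃ W ∈ nhds x, Set.InjOn f W) :
    ∃ A : ℕ → Set X, (∀ j, MeasurableSet (A j)) ∧ Pairwise (Function.onFun Disjoint A) ∧
      ⋃ j, A j = O ∧ ∀ j, Set.InjOn f (A j) := by
  rcases O.eq_empty_or_nonempty with rfl | ⟨x₀, hx₀⟩
  · exact ⟨fun _ => ∅, fun _ => .empty, fun _ _ _ => disjoint_bot_left, by simp, by simp⟩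
  choose! W hW hWinj using h
  obtain ⟨t, htO, ht, hcov⟩ := TopologicalSpace.countable_cover_nhdsWithin (s := O)
    (f := fun x => interior (W x))
    fun x hx => mem_nhdsWithin_of_mem_nhds (interior_mem_nhds.2 (hW x hx))
  have htne : t.Nonempty := by
    obtain ⟨x, hx, -⟩ := Set.mem_iUnion₂.1 (hcov hx₀)
    exact ⟨x, hx⟩
  obtain ⟨e, rfl⟩ := ht.exists_eq_range htne
  rw [Set.biUnion_range] at hcov
  refine ⟨fun j => O ∩ disjointed (fun i => interior (W (e i))) j, fun j =>
    hO.inter (MeasurableSet.disjointed (fun i => isOpen_interior.measurableSet) j), ?_, ?_, ?_⟩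
  · exact fun i j hij => (disjoint_disjointed _ hij).mono Set.inter_subset_right
      Set.inter_subset_right
  · rw [← Set.inter_iUnion, iUnion_disjointed, Set.inter_eq_left.2 hcov]
  · refine fun j => (hWinj (e j) (htO (Set.mem_range_self j))).mono ?_
    exact Set.inter_subset_right.trans ((disjointed_subset _ j).trans interior_subset)

/-- The area of a piece of a graph, as a kinematic measure counted with multiplicity. -/
theorem tsum_kinematicMeasure_graphLine_image (hn : 1 ≤ n) (hg : ContDiff ℝ 1 g) {D : Set (perp a)}
    (hD : MeasurableSet D) {A : ℕ → Set (UnitSphere n × perp a)} (hA : ∀ j, MeasurableSet (A j))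
    (hdisj : Pairwise (Function.onFun Disjoint A))
    (hcov : ⋃ j, A j = {q | q.2 ∈ D ∧ conormal a g q.2 q.1 ≠ 0})
    (hinj : ∀ j, Set.InjOn (graphLine a g) (A j)) {B : Set (perp a)} (hB : MeasurableSet B) :
    ∑' j, kinematicMeasure n (graphLine a g '' (A j ∩ Prod.snd ⁻¹' B)) =
      ENNReal.ofReal (2 * ballVolume (n - 1)) * μHE[n - 1] (graphMap a g '' (D ∩ B)) := by
  have hAB : ∀ j, MeasurableSet (A j ∩ Prod.snd ⁻¹' B) := fun j =>
    (hA j).inter (measurable_snd hB)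
  have hc : Measurable fun q : UnitSphere n × perp a => ‖conormal a g q.2 q.1‖ₑ :=
    (continuous_conormal_apply a hg).measurable.enorm
  have hDB : MeasurableSet (Prod.snd ⁻¹' (D ∩ B) : Set (UnitSphere n × perp a)) :=
    measurable_snd (hD.inter hB)
  have hcc : Measurable fun y => ‖conormal a g y‖ₑ := (continuous_conormal a hg).measurable.enorm
  simp only [fun j => kinematicMeasure_graphLine_image a hg (hAB j)
    ((hinj j).mono Set.inter_subset_left)]
  rw [← lintegral_iUnion hAB fun i j hij => (hdisj hij).mono Set.inter_subset_left
    Set.inter_subset_left, ← Set.iUnion_inter, hcov,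
    euclideanHausdorffMeasure_graphMap_image a hg (hD.inter hB)]
  -- Tangential pairs may be put back, since the density vanishes there.
  have e : ∫⁻ q in {q : UnitSphere n × perp a | q.2 ∈ D ∧ conormal a g q.2 q.1 ≠ 0} ∩
        Prod.snd ⁻¹' B, ‖conormal a g q.2 q.1‖ₑ
          ∂((volume : Measure (E n)).toSphere.prod volume) =
      ∫⁻ q in Prod.snd ⁻¹' (D ∩ B), ‖conormal a g q.2 q.1‖ₑ
          ∂((volume : Measure (E n)).toSphere.prod volume) := by
    rw [← hcov, ← lintegral_indicator ((MeasurableSet.iUnion hA).inter (measurable_snd hB)),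
      ← lintegral_indicator hDB, hcov]
    refine lintegral_congr fun q => ?_
    by_cases hq : q.2 ∈ D ∩ B
    · rw [Set.indicator_of_mem (s := Prod.snd ⁻¹' (D ∩ B)) hq]
      by_cases h0 : conormal a g q.2 q.1 = 0
      · rw [Set.indicator_of_notMem fun h => h.1.2 h0, h0, enorm_zero]
      · exact Set.indicator_of_mem (s := {q : UnitSphere n × perp a | q.2 ∈ D ∧
          conormal a g q.2 q.1 ≠ 0} ∩ Prod.snd ⁻¹' B) ⟨⟨hq.1, h0⟩, hq.2⟩ _
    · rw [Set.indicator_of_notMem (s := Prod.snd ⁻¹' (D ∩ B)) hq,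
        Set.indicator_of_notMem fun h => hq ⟨h.1.1, h.2⟩]
  -- Exchange the order: for a fixed point the integral over directions is the spherical mean of its
  -- conormal.
  rw [e, ← lintegral_indicator hDB, lintegral_prod_symm _ (hc.indicator hDB).aemeasurable,
    ← lintegral_const_mul _ hcc, ← lintegral_indicator (hD.inter hB)]
  refine lintegral_congr fun y => ?_
  have e2 : ∀ v : UnitSphere n, (Prod.snd ⁻¹' (D ∩ B)).indicator
      (fun q : UnitSphere n × perp a => ‖conormal a g q.2 q.1‖ₑ) (v, y) =
        (D ∩ B).indicator (fun y => ‖conormal a g y v‖ₑ) y := fun v => rfl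
  simp only [e2]
  by_cases hy : y ∈ D ∩ B
  · simp only [Set.indicator_of_mem hy]
    exact lintegral_toSphere_enorm hn _
  · simp only [Set.indicator_of_notMem hy, lintegral_zero]

end Lines

/-! ### Global extensions of graph pieces -/

section Pieces

variable {n : ℕ}

/-- Multiply by a cutoff that is 1 near `s` and 0 off a closed subset of `U`. Agreement near each
point of `s`, not just on `s`, preserves derivatives and hence tangent hyperplanes. -/
theorem exists_contDiff_extension {V : Type*} [NormedAddCommGroup V] [InnerProductSpace ℝ V]
    [FiniteDimensional ℝ V] {s U : Set V} (hs : IsClosed s) (hU : IsOpen U) (hsU : s ⊆ U)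
    {h : V → ℝ} (hh : ContDiffOn ℝ ∞ h U) :
    ∃ g : V → ℝ, ContDiff ℝ 1 g ∧ ∀ y ∈ s, g =ᶠ[nhds y] h := by
  obtain ⟨O, hO, hsO, hOU⟩ := normal_exists_closure_subset hs hU hsU
  obtain ⟨χ, hχ1, hχ0, -⟩ := exists_contMDiffMap_one_nhds_of_subset_interior
    (n := 1) (modelWithCornersSelf ℝ V) (t := closure O) hs
    (hsO.trans (hO.subset_interior_iff.2 subset_closure))
  have hχ : ContDiff ℝ 1 χ := χ.contMDiff.contDiff
  refine ⟨fun y => χ y * h y, contDiff_iff_contDiffAt.2 fun y => ?_, fun y hy => ?_⟩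
  · by_cases hy : y ∈ U
    · exact hχ.contDiffAt.mul
        (((hh y hy).contDiffAt (hU.mem_nhds hy)).of_le (mod_cast le_top))
    · have hy' : y ∈ (closure O)ᶜ := fun h => hy (hOU h)
      refine (contDiffAt_const (c := (0 : ℝ))).congr_of_eventuallyEq ?_
      filter_upwards [isClosed_closure.isOpen_compl.mem_nhds hy'] with z hz
      rw [hχ0 z hz, zero_mul]
  · filter_upwards [(eventually_nhdsSet_iff_forall.1 hχ1) y hy] with z hz
    rw [hz, one_mul]

namespace GraphPiece

variable (P : GraphPiece n)

theorem exists_extension : ∃ g : perp P.axis → ℝ, ContDiff ℝ 1 g ∧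
    ∀ y ∈ closure P.base, g =ᶠ[nhds y] P.height := by
  obtain ⟨U, hU, hsU, hh⟩ := P.smooth_height
  exact exists_contDiff_extension isClosed_closure hU hsU hh

/-- A global extension of the height function of a graph piece. -/
def ext : perp P.axis → ℝ := P.exists_extension.choose

theorem contDiff_ext : ContDiff ℝ 1 P.ext := P.exists_extension.choose_spec.1

theorem param_eventuallyEq {y : perp P.axis} (hy : y ∈ closure P.base) :
    P.param =ᶠ[nhds y] graphMap P.axis P.ext := by
  filter_upwards [P.exists_extension.choose_spec.2 y hy] with z hz
  rw [param, graphMap, ext, hz]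

theorem param_eq {y : perp P.axis} (hy : y ∈ closure P.base) :
    P.param y = graphMap P.axis P.ext y := (P.param_eventuallyEq hy).self_of_nhds

theorem carrier_eq : P.carrier = graphMap P.axis P.ext '' closure P.base :=
  Set.image_congr fun _ hy => P.param_eq hy

theorem isCompact_closure_base : IsCompact (closure P.base) := P.isBounded_base.isCompact_closure

theorem isCompact_carrier : IsCompact P.carrier := by
  rw [carrier_eq]
  exact P.isCompact_closure_base.image (continuous_graphMap _ P.contDiff_ext)

theorem mem_carrier_iff {y : perp P.axis} :
    graphMap P.axis P.ext y ∈ P.carrier ↔ y ∈ closure P.base := by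
  rw [carrier_eq, (graphMap_injective P.axis P.ext).mem_set_image]

theorem fderiv_param {y : perp P.axis} (hy : y ∈ closure P.base) :
    fderiv ℝ P.param y = graphDeriv P.axis P.ext y := by
  rw [(P.param_eventuallyEq hy).fderiv_eq]
  exact (hasStrictFDerivAt_graphMap P.axis P.contDiff_ext y).hasFDerivAt.fderiv

/-- The tangent space is the kernel of a nonzero linear form, so a vector complements it exactly
when the form does not vanish there. -/
theorem span_sup_tangentSpace_eq_top_iff {y : perp P.axis} (hy : y ∈ closure P.base) (v : E n) :
    Submodule.span ℝ {v} ⊔ P.tangentSpace y = ⊤ ↔ conormal P.axis P.ext y v ≠ 0 := by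
  have hT : P.tangentSpace y = LinearMap.ker (conormal P.axis P.ext y).toLinearMap := by
    rw [tangentSpace, P.fderiv_param hy]
    ext x
    constructor
    · rintro ⟨w, rfl⟩
      exact conormal_graphDeriv P.axis P.ext y w
    · intro hx
      exact ⟨perpProj P.axis x, graphDeriv_perpProj_of_conormal_eq_zero P.axis P.ext y hx⟩
  rw [hT]
  constructor
  · intro h h0
    have hle : Submodule.span ℝ {v} ⊔ LinearMap.ker (conormal P.axis P.ext y).toLinearMap ≤
        LinearMap.ker (conormal P.axis P.ext y).toLinearMap := by
      refine sup_le ?_ le_rfl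
      rw [Submodule.span_singleton_le_iff_mem]
      exact h0
    have h1 : (P.axis : E n) ∈ LinearMap.ker (conormal P.axis P.ext y).toLinearMap := by
      rw [h] at hle
      exact hle Submodule.mem_top
    have h2 : conormal P.axis P.ext y (P.axis : E n) = 0 := h1
    rw [conormal_axis] at h2
    exact one_ne_zero h2
  · intro h0
    rw [eq_top_iff]
    intro x _
    let c := conormal P.axis P.ext y x / conormal P.axis P.ext y v
    refine Submodule.mem_sup.2 ⟨c • v, Submodule.smul_mem _ _ (Submodule.mem_span_singleton_self v),
      x - c • v, ?_, by abel⟩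
    change conormal P.axis P.ext y (x - c • v) = 0
    rw [map_sub, map_smul, smul_eq_mul, div_mul_cancel₀ _ h0, sub_self]

end GraphPiece

namespace CompactHypersurface

variable (S : CompactHypersurface n)

theorem isCompact_carrier : IsCompact S.carrier :=
  isCompact_iUnion fun i => (S.piece i).isCompact_carrier

instance : CompactSpace S.carrier := isCompact_iff_compactSpace.1 S.isCompact_carrier

theorem measurableSet_carrier : MeasurableSet S.carrier := S.isCompact_carrier.measurableSet

theorem area_apply (B : Set S.carrier) : S.area B = μHE[n - 1] (Subtype.val '' B) :=
  (MeasurableEmbedding.subtype_coe S.measurableSet_carrier).comap_apply _ _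

instance : IsFiniteMeasure S.area := by
  refine ⟨?_⟩
  rw [area_apply, Set.image_univ, Subtype.range_coe]
  refine (measure_iUnion_le _).trans_lt ?_
  rw [tsum_fintype, ENNReal.sum_lt_top]
  intro i _
  have hc := (continuous_conormal (S.piece i).axis (S.piece i).contDiff_ext)
  rw [(S.piece i).carrier_eq, euclideanHausdorffMeasure_graphMap_image _ (S.piece i).contDiff_ext
    isClosed_closure.measurableSet]
  exact (hc.continuousOn.integrableOn_compact (S.piece i).isCompact_closure_base).2

/-! ### The intersection points of a line with a hypersurface -/

/-- The set of points of the `i`-th piece, in its parametrization, which lie on no earlier piece. -/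
def freshBase (i : Fin S.numPieces) : Set (perp (S.piece i).axis) :=
  closure (S.piece i).base \
    ⋃ j : {j // j < i}, graphMap (S.piece i).axis (S.piece i).ext ⁻¹' (S.piece j).carrier

theorem measurableSet_freshBase (i : Fin S.numPieces) : MeasurableSet (S.freshBase i) :=
  isClosed_closure.measurableSet.diff <| MeasurableSet.iUnion fun j =>
    ((S.piece j).isCompact_carrier.isClosed.preimage
      (continuous_graphMap _ (S.piece i).contDiff_ext)).measurableSet

theorem graphMap_mem_carrier {i : Fin S.numPieces} {y : perp (S.piece i).axis}
    (hy : y ∈ closure (S.piece i).base) :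
    graphMap (S.piece i).axis (S.piece i).ext y ∈ S.carrier :=
  Set.mem_iUnion.2 ⟨i, (S.piece i).mem_carrier_iff.2 hy⟩

theorem exists_freshBase {x : E n} (hx : x ∈ S.carrier) :
    ∃ i, ∃ y ∈ S.freshBase i, graphMap (S.piece i).axis (S.piece i).ext y = x := by
  classical
  have h : ∃ i, x ∈ (S.piece i).carrier := Set.mem_iUnion.1 hx
  obtain ⟨i, hi, hmin⟩ := WellFounded.has_min (wellFounded_lt (α := Fin S.numPieces))
    {i | x ∈ (S.piece i).carrier} h
  have hi' : x ∈ (S.piece i).carrier := hi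
  rw [(S.piece i).carrier_eq] at hi'
  obtain ⟨y, hy, rfl⟩ := hi'
  refine ⟨i, y, ⟨hy, fun hmem => ?_⟩, rfl⟩
  obtain ⟨⟨j, hj⟩, hxj⟩ := Set.mem_iUnion.1 hmem
  exact hmin j hxj hj

theorem freshBase_index_eq {i j : Fin S.numPieces} {y : perp (S.piece i).axis}
    {z : perp (S.piece j).axis} (hy : y ∈ S.freshBase i) (hz : z ∈ S.freshBase j)
    (h : graphMap (S.piece i).axis (S.piece i).ext y =
      graphMap (S.piece j).axis (S.piece j).ext z) : i = j := by
  have key : ∀ {i j : Fin S.numPieces} {y : perp (S.piece i).axis} {z : perp (S.piece j).axis},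
      y ∈ S.freshBase i → z ∈ S.freshBase j → graphMap (S.piece i).axis (S.piece i).ext y =
        graphMap (S.piece j).axis (S.piece j).ext z → ¬ i < j := by
    intro i j y z hy hz h hij
    refine hz.2 (Set.mem_iUnion.2 ⟨⟨i, hij⟩, ?_⟩)
    change graphMap (S.piece j).axis (S.piece j).ext z ∈ (S.piece i).carrier
    rw [← h]
    exact (S.piece i).mem_carrier_iff.2 hy.1
  exact le_antisymm (not_lt.1 (key hz hy h.symm)) (not_lt.1 (key hy hz h))

/-- The fresh parts partition the hypersurface, so overlaps of pieces are counted once. -/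
theorem area_eq_sum {B : Set (E n)} (hB : MeasurableSet B) :
    S.area (Subtype.val ⁻¹' B) = ∑ i, μHE[n - 1] (graphMap (S.piece i).axis (S.piece i).ext ''
      (S.freshBase i ∩ graphMap (S.piece i).axis (S.piece i).ext ⁻¹' B)) := by
  have hset : (Subtype.val '' (Subtype.val ⁻¹' B : Set S.carrier) : Set (E n)) =
      ⋃ i, graphMap (S.piece i).axis (S.piece i).ext ''
        (S.freshBase i ∩ graphMap (S.piece i).axis (S.piece i).ext ⁻¹' B) := by
    ext x
    simp only [Set.mem_image, Set.mem_iUnion]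
    constructor
    · rintro ⟨x, hx, rfl⟩
      obtain ⟨i, y, hy, hyx⟩ := S.exists_freshBase x.2
      refine ⟨i, y, ⟨hy, ?_⟩, hyx⟩
      rw [Set.mem_preimage, hyx]
      exact hx
    · rintro ⟨i, y, ⟨hy, hyB⟩, rfl⟩
      exact ⟨⟨_, S.graphMap_mem_carrier hy.1⟩, hyB, rfl⟩
  rw [area_apply, hset, measure_iUnion, tsum_fintype]
  · intro i j hij
    refine Set.disjoint_left.2 ?_
    rintro _ ⟨y, hy, rfl⟩ ⟨z, hz, hzy⟩
    exact hij (S.freshBase_index_eq hy.1 hz.1 hzy.symm)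
  · intro i
    have hc := continuous_graphMap (S.piece i).axis (S.piece i).contDiff_ext
    exact ((S.measurableSet_freshBase i).inter (hc.measurable hB)).image_of_continuousOn_injOn
      hc.continuousOn (graphMap_injective _ _).injOn

end CompactHypersurface

end Pieces

/-! ### The Cauchy–Crofton formula -/

section Intersection

open scoped ENNReal
open ProbabilityTheory

variable {n : ℕ}

namespace CompactHypersurface

variable (S : CompactHypersurface n)

/-- The points of a hypersurface on a line. -/
def onLine (l : OrientedLine n) : Set S.carrier := {x | (x : E n) ∈ OrientedLine.points l}

/-- The full closed bases occur here, not the fresh parts, since transversality is tested on every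
sheet through a point. -/
theorem not_isTransverse_eq : {l : OrientedLine n | ¬ l.IsTransverse S} =
    ⋃ i, graphLine (S.piece i).axis (S.piece i).ext '' {q | q.2 ∈ closure (S.piece i).base ∧
      conormal (S.piece i).axis (S.piece i).ext q.2 q.1 = 0} := by
  ext l
  simp only [Set.mem_iUnion]
  constructor
  · intro h
    change ¬ ∀ i, _ at h
    push Not at h
    obtain ⟨i, y, hy, hyl, hne⟩ := h
    refine ⟨i, (l.dir, y), ⟨hy, ?_⟩, ?_⟩
    · by_contra hc
      exact hne (((S.piece i).span_sup_tangentSpace_eq_top_iff hy _).2 hc)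
    · rw [(S.piece i).param_eq hy, mem_points_iff] at hyl
      exact hyl
  · rintro ⟨i, ⟨v, y⟩, ⟨hy, h0⟩, rfl⟩ hT
    refine ((S.piece i).span_sup_tangentSpace_eq_top_iff hy (v : E n)).1 (hT i y hy ?_) h0
    rw [(S.piece i).param_eq hy, mem_points_iff]
    rfl

/-- Measurability comes from compactness: the tangential pairs over a closed base form a compact
set, whose image under a continuous map is compact. -/
theorem measurableSet_not_isTransverse :
    MeasurableSet {l : OrientedLine n | ¬ l.IsTransverse S} ∧
      kinematicMeasure n {l : OrientedLine n | ¬ l.IsTransverse S} = 0 := by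
  have hm : ∀ i, MeasurableSet (graphLine (S.piece i).axis (S.piece i).ext ''
      {q | q.2 ∈ closure (S.piece i).base ∧
        conormal (S.piece i).axis (S.piece i).ext q.2 q.1 = 0}) := by
    intro i
    have hcl : IsClosed {q : UnitSphere n × perp (S.piece i).axis |
        conormal (S.piece i).axis (S.piece i).ext q.2 q.1 = 0} :=
      isClosed_eq (continuous_conormal_apply _ (S.piece i).contDiff_ext) continuous_const
    have hK := ((isCompact_univ (X := UnitSphere n)).prod
      (S.piece i).isCompact_closure_base).inter_right hcl
    have e : {q : UnitSphere n × perp (S.piece i).axis | q.2 ∈ closure (S.piece i).base ∧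
        conormal (S.piece i).axis (S.piece i).ext q.2 q.1 = 0} =
        ((Set.univ : Set (UnitSphere n)) ×ˢ closure (S.piece i).base) ∩
          {q | conormal (S.piece i).axis (S.piece i).ext q.2 q.1 = 0} := by
      ext q
      simp
    rw [e]
    exact (hK.image (continuous_graphLine _ (S.piece i).contDiff_ext)).measurableSet
  rw [not_isTransverse_eq]
  refine ⟨MeasurableSet.iUnion hm, measure_iUnion_null fun i => ?_⟩
  exact kinematicMeasure_graphLine_image_eq_zero _ (S.piece i).contDiff_ext
    (fun q hq => hq.2) (hm i)

theorem exists_sheets (i : Fin S.numPieces) :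
    ∃ A : ℕ → Set (UnitSphere n × perp (S.piece i).axis), (∀ j, MeasurableSet (A j)) ∧
      Pairwise (Function.onFun Disjoint A) ∧ ⋃ j, A j = {q | q.2 ∈ S.freshBase i ∧
        conormal (S.piece i).axis (S.piece i).ext q.2 q.1 ≠ 0} ∧
      ∀ j, Set.InjOn (graphLine (S.piece i).axis (S.piece i).ext) (A j) := by
  refine exists_countable_injOn_decomposition ?_ ?_
  · refine (measurable_snd (S.measurableSet_freshBase i)).inter ?_
    exact ((isClosed_eq (continuous_conormal_apply _ (S.piece i).contDiff_ext)
      continuous_const).measurableSet).compl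
  · rintro ⟨v, y⟩ ⟨-, h0⟩
    exact exists_nhds_injOn_graphLine _ (S.piece i).contDiff_ext h0

/-- A countable partition of the transversal pairs of a direction and a point of the `i`-th piece,
such that on every part a line determines the point. -/
def sheet (i : Fin S.numPieces) : ℕ → Set (UnitSphere n × perp (S.piece i).axis) :=
  (S.exists_sheets i).choose

theorem measurableSet_sheet (i : Fin S.numPieces) (j : ℕ) : MeasurableSet (S.sheet i j) :=
  (S.exists_sheets i).choose_spec.1 j

theorem pairwise_disjoint_sheet (i : Fin S.numPieces) :
    Pairwise (Function.onFun Disjoint (S.sheet i)) :=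
  (S.exists_sheets i).choose_spec.2.1

theorem iUnion_sheet (i : Fin S.numPieces) : ⋃ j, S.sheet i j = {q | q.2 ∈ S.freshBase i ∧
    conormal (S.piece i).axis (S.piece i).ext q.2 q.1 ≠ 0} :=
  (S.exists_sheets i).choose_spec.2.2.1

theorem injOn_sheet (i : Fin S.numPieces) (j : ℕ) :
    Set.InjOn (graphLine (S.piece i).axis (S.piece i).ext) (S.sheet i j) :=
  (S.exists_sheets i).choose_spec.2.2.2 j

/-- The lines whose intersection point with the `j`-th sheet of the `i`-th piece lies in `B`. -/
def sheetLines (B : Set (E n)) (i : Fin S.numPieces) (j : ℕ) : Set (OrientedLine n) :=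
  graphLine (S.piece i).axis (S.piece i).ext ''
    (S.sheet i j ∩ Prod.snd ⁻¹' (graphMap (S.piece i).axis (S.piece i).ext ⁻¹' B))

theorem measurableSet_sheetLines {B : Set (E n)} (hB : MeasurableSet B) (i : Fin S.numPieces)
    (j : ℕ) : MeasurableSet (S.sheetLines B i j) := by
  have hc := continuous_graphMap (S.piece i).axis (S.piece i).contDiff_ext
  exact ((S.measurableSet_sheet i j).inter (measurable_snd
    (hc.measurable hB))).image_of_continuousOn_injOn
      (continuous_graphLine _ (S.piece i).contDiff_ext).continuousOn
      ((S.injOn_sheet i j).mono Set.inter_subset_left)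

/-- The number of intersection points in `B` of a line with the sheets of a hypersurface. -/
def sheetCount (B : Set (E n)) (l : OrientedLine n) : ℝ≥0∞ :=
  ∑ i, ∑' j, (S.sheetLines B i j).indicator 1 l

theorem measurable_sheetCount {B : Set (E n)} (hB : MeasurableSet B) :
    Measurable (S.sheetCount B) :=
  Finset.measurable_sum _ fun i _ => Measurable.tsum fun j =>
    measurable_one.indicator (S.measurableSet_sheetLines hB i j)

/-- The one-line formula tested on `B`: on each sheet lines and marked points correspond
bijectively, so measures of sets of lines add up to area. -/
theorem lintegral_sheetCount (hn : 1 ≤ n) {B : Set (E n)} (hB : MeasurableSet B) :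
    ∫⁻ l, S.sheetCount B l ∂(kinematicMeasure n) =
      ENNReal.ofReal (2 * ballVolume (n - 1)) * S.area (Subtype.val ⁻¹' B) := by
  have hm : ∀ i j, Measurable ((S.sheetLines B i j).indicator (1 : OrientedLine n → ℝ≥0∞)) :=
    fun i j => measurable_one.indicator (S.measurableSet_sheetLines hB i j)
  unfold sheetCount
  rw [lintegral_finsetSum _ fun i _ => Measurable.tsum (hm i), S.area_eq_sum hB,
    Finset.mul_sum]
  refine Finset.sum_congr rfl fun i _ => ?_
  have hc := continuous_graphMap (S.piece i).axis (S.piece i).contDiff_ext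
  rw [lintegral_tsum fun j => (hm i j).aemeasurable,
    ← tsum_kinematicMeasure_graphLine_image _ hn (S.piece i).contDiff_ext
      (S.measurableSet_freshBase i) (S.measurableSet_sheet i) (S.pairwise_disjoint_sheet i)
      (S.iUnion_sheet i) (S.injOn_sheet i) (hc.measurable hB)]
  refine tsum_congr fun j => ?_
  rw [lintegral_indicator_one (S.measurableSet_sheetLines hB i j)]
  rfl

/-- Each intersection point lies in one fresh part and, the line being transverse, in one sheet;
each sheet contributes at most one point. The geometric count thus equals a visibly measurable
function. -/
theorem count_onLine_eq {l : OrientedLine n} (hl : l.IsTransverse S) (B : Set (E n)) :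
    Measure.count (S.onLine l ∩ Subtype.val ⁻¹' B) = S.sheetCount B l := by
  let C : Fin S.numPieces × ℕ → Set S.carrier := fun p =>
    {x | (x : E n) ∈ B ∧ ∃ q ∈ S.sheet p.1 p.2,
      graphLine (S.piece p.1).axis (S.piece p.1).ext q = l ∧
        graphMap (S.piece p.1).axis (S.piece p.1).ext q.2 = x}
  have hmem : ∀ {i j q}, q ∈ S.sheet i j → q.2 ∈ S.freshBase i ∧
      conormal (S.piece i).axis (S.piece i).ext q.2 q.1 ≠ 0 := by
    intro i j q hq
    have : q ∈ ⋃ j, S.sheet i j := Set.mem_iUnion.2 ⟨j, hq⟩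
    rwa [iUnion_sheet] at this
  have hsub : ∀ p, (C p).Subsingleton := by
    rintro p x ⟨-, q, hq, hql, hqx⟩ x' ⟨-, q', hq', hql', hqx'⟩
    have : q = q' := S.injOn_sheet p.1 p.2 hq hq' (hql.trans hql'.symm)
    subst this
    exact Subtype.ext (hqx.symm.trans hqx')
  have hcount : ∀ p, Measure.count (C p) = (S.sheetLines B p.1 p.2).indicator 1 l := by
    intro p
    rcases (hsub p).eq_empty_or_singleton with h | ⟨x, h⟩
    · rw [h, measure_empty, Set.indicator_of_notMem]
      rintro ⟨q, ⟨hq, hqB⟩, rfl⟩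
      have : (⟨_, S.graphMap_mem_carrier (hmem hq).1.1⟩ : S.carrier) ∈ C p :=
        ⟨hqB, q, hq, rfl, rfl⟩
      rw [h] at this
      exact this
    · have hx : x ∈ C p := h ▸ Set.mem_singleton x
      obtain ⟨hxB, q, hq, hql, hqx⟩ := hx
      rw [h, Measure.count_singleton, Set.indicator_of_mem, Pi.one_apply]
      refine ⟨q, ⟨hq, ?_⟩, hql⟩
      rw [Set.mem_preimage, Set.mem_preimage, hqx]
      exact hxB
  have hunion : S.onLine l ∩ Subtype.val ⁻¹' B = ⋃ p, C p := by
    ext x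
    rw [Set.mem_iUnion]
    constructor
    · rintro ⟨hxl, hxB⟩
      obtain ⟨i, y, hy, hyx⟩ := S.exists_freshBase x.2
      have hyl : graphMap (S.piece i).axis (S.piece i).ext y ∈ OrientedLine.points l := by
        rw [hyx]
        exact hxl
      have hT := hl i y hy.1 (by rwa [(S.piece i).param_eq hy.1])
      have h0 := ((S.piece i).span_sup_tangentSpace_eq_top_iff hy.1 _).1 hT
      have hq : ((l.dir, y) : UnitSphere n × perp (S.piece i).axis) ∈ ⋃ j, S.sheet i j := by
        rw [iUnion_sheet]
        exact ⟨hy, h0⟩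
      obtain ⟨j, hj⟩ := Set.mem_iUnion.1 hq
      exact ⟨(i, j), hxB, _, hj, (mem_points_iff l _).1 hyl, hyx⟩
    · rintro ⟨p, hxB, q, hq, hql, hqx⟩
      refine ⟨?_, hxB⟩
      change (x : E n) ∈ OrientedLine.points l
      rw [← hqx, ← hql, mem_points_iff]
      rfl
  have hdisj : Pairwise (Function.onFun Disjoint C) := by
    rintro ⟨i, j⟩ ⟨i', j'⟩ hne
    refine Set.disjoint_left.2 ?_
    rintro x ⟨-, q, hq, hql, hqx⟩ ⟨-, q', hq', hql', hqx'⟩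
    have hi : i = i' := S.freshBase_index_eq (hmem hq).1 (hmem hq').1 (hqx.trans hqx'.symm)
    subst hi
    have h2 : q.2 = q'.2 := graphMap_injective _ _ (hqx.trans hqx'.symm)
    have h1 : q.1 = q'.1 := congrArg OrientedLine.dir (hql.trans hql'.symm)
    have hqq : q = q' := Prod.ext h1 h2
    subst hqq
    have hj : j ≠ j' := fun h => hne (by rw [h])
    exact Set.disjoint_left.1 (S.pairwise_disjoint_sheet i hj) hq hq'
  rw [hunion, measure_iUnion hdisj fun p => (hsub p).measurableSet, ENNReal.tsum_prod',
    tsum_fintype]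
  simp only [hcount]
  rfl

/-- The lines that are transverse to a hypersurface and meet it in finitely many points. -/
def goodLines : Set (OrientedLine n) := {l | l.IsTransverse S ∧ (S.onLine l).Finite}

theorem sheetCount_univ_lt_top_iff {l : OrientedLine n} (hl : l.IsTransverse S) :
    S.sheetCount Set.univ l < ⊤ ↔ (S.onLine l).Finite := by
  rw [← S.count_onLine_eq hl, Set.preimage_univ, Set.inter_univ]
  exact Measure.count_apply_lt_top

theorem goodLines_eq : S.goodLines =
    {l | ¬ l.IsTransverse S}ᶜ ∩ {l | S.sheetCount Set.univ l < ⊤} := by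
  ext l
  constructor
  · rintro ⟨h1, h2⟩
    exact ⟨not_not.2 h1, (S.sheetCount_univ_lt_top_iff h1).2 h2⟩
  · rintro ⟨h1, h2⟩
    have h1' : l.IsTransverse S := not_not.1 h1
    exact ⟨h1', (S.sheetCount_univ_lt_top_iff h1').1 h2⟩

theorem measurableSet_goodLines : MeasurableSet S.goodLines := by
  rw [goodLines_eq]
  exact S.measurableSet_not_isTransverse.1.compl.inter
    (measurableSet_lt (S.measurable_sheetCount .univ) measurable_const)

/-- Finiteness of the intersection is needed only almost everywhere, and follows because the count
has finite integral. -/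
theorem ae_mem_goodLines (hn : 1 ≤ n) : ∀ᵐ l ∂(kinematicMeasure n), l ∈ S.goodLines := by
  have h1 : ∀ᵐ l ∂(kinematicMeasure n), l ∈ {l : OrientedLine n | ¬ l.IsTransverse S}ᶜ :=
    measure_eq_zero_iff_ae_notMem.1 S.measurableSet_not_isTransverse.2
  have h2 : ∀ᵐ l ∂(kinematicMeasure n), S.sheetCount Set.univ l < ⊤ := by
    refine ae_lt_top (S.measurable_sheetCount .univ) ?_
    rw [S.lintegral_sheetCount hn .univ]
    exact ENNReal.mul_ne_top ENNReal.ofReal_ne_top (measure_ne_top _ _)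
  rw [goodLines_eq]
  filter_upwards [h1, h2] with l hl1 hl2 using ⟨hl1, hl2⟩

open Classical in
/-- The kernel which sends a line to the counting measure of its intersection with a
hypersurface. -/
def intersectionKernel : Kernel (OrientedLine n) S.carrier where
  -- The value 0 on the null set of bad lines makes every measure of the kernel finite, as the
  -- product kernel requires.
  toFun l := if l ∈ S.goodLines then Measure.count.restrict (S.onLine l) else 0
  measurable' := by
    refine Measure.measurable_of_measurable_coe _ ?_
    rintro _ ⟨B, hB, rfl⟩
    convert (S.measurable_sheetCount hB).indicator S.measurableSet_goodLines using 1
    ext l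
    by_cases hl : l ∈ S.goodLines
    · rw [Set.indicator_of_mem hl, if_pos hl, Measure.restrict_apply (measurable_subtype_coe hB),
        Set.inter_comm, S.count_onLine_eq hl.1]
    · rw [Set.indicator_of_notMem hl, if_neg hl, Measure.coe_zero, Pi.zero_apply]

theorem intersectionKernel_of_mem {l : OrientedLine n} (hl : l ∈ S.goodLines) :
    S.intersectionKernel l = Measure.count.restrict (S.onLine l) := if_pos hl

theorem intersectionKernel_of_notMem {l : OrientedLine n} (hl : l ∉ S.goodLines) :
    S.intersectionKernel l = 0 := if_neg hl

/-- In this form a product of such measures expands into the sum over tuples that defines `lineSum`.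
-/
theorem intersectionKernel_eq_sum_dirac {l : OrientedLine n} (hl : l ∈ S.goodLines) :
    S.intersectionKernel l = ∑ x ∈ hl.2.toFinset, Measure.dirac x := by
  classical
  rw [S.intersectionKernel_of_mem hl]
  ext B hB
  have e : B ∩ S.onLine l = ((hl.2.toFinset.filter (· ∈ B) : Finset S.carrier) : Set S.carrier) := by
    ext x
    simp [and_comm]
  rw [Measure.restrict_apply hB, e, Measure.count_apply_finset, Measure.coe_finsetSum,
    Finset.sum_apply]
  simp only [fun x : S.carrier => Measure.dirac_apply' x hB, Set.indicator_apply, Pi.one_apply]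
  rw [Finset.sum_boole]

instance (l : OrientedLine n) : IsFiniteMeasure (S.intersectionKernel l) := by
  by_cases hl : l ∈ S.goodLines
  · rw [S.intersectionKernel_eq_sum_dirac hl]
    infer_instance
  · rw [S.intersectionKernel_of_notMem hl]
    infer_instance

/-- The Cauchy–Crofton formula for one line. -/
theorem bind_intersectionKernel (hn : 1 ≤ n) :
    (kinematicMeasure n).bind S.intersectionKernel =
      ENNReal.ofReal (2 * ballVolume (n - 1)) • S.area := by
  ext B' hB'
  obtain ⟨B, hB, rfl⟩ := hB'
  have hBm : MeasurableSet (Subtype.val ⁻¹' B : Set S.carrier) := measurable_subtype_coe hB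
  rw [Measure.bind_apply hBm S.intersectionKernel.measurable.aemeasurable, Measure.smul_apply,
    smul_eq_mul, ← S.lintegral_sheetCount hn hB]
  refine lintegral_congr_ae ?_
  filter_upwards [S.ae_mem_goodLines hn] with l hl
  rw [S.intersectionKernel_of_mem hl, Measure.restrict_apply hBm, Set.inter_comm,
    S.count_onLine_eq hl.1]

theorem lineSum_eq_integral {k : ℕ} (f : (Fin k → S.carrier) → ℝ) {l : Fin k → OrientedLine n}
    (hl : ∀ i, l i ∈ S.goodLines) :
    lineSum S f l = ∫ x, f x ∂(piKernel S.intersectionKernel k l) := by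
  rw [piKernel_apply]
  simp only [fun i => S.intersectionKernel_eq_sum_dirac (hl i)]
  rw [integral_pi_sum_dirac, lineSum, if_pos fun i => (hl i).1]
  simp only [Set.Finite.mem_toFinset]
  rfl

end CompactHypersurface

theorem ballVolume_pos (m : ℕ) : 0 < ballVolume m :=
  ENNReal.toReal_pos (Metric.measure_ball_pos _ _ one_pos).ne' measure_ball_lt_top.ne

end Intersection

end CauchyCrofton

end

/-! ### The formula for `k` lines. -/

open CauchyCrofton in
theorem mainTheorem3 (n : ℕ) (hn : 1 ≤ n) (S : CompactHypersurface n) (k : ℕ)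
    (f : (Fin k → S.carrier) → ℝ) (hf : Continuous f) :
    Integrable f (Measure.pi fun _ : Fin k => S.area) ∧
    Integrable (lineSum S f) (Measure.pi fun _ : Fin k => kinematicMeasure n) ∧
    ∫ x, f x ∂(Measure.pi fun _ : Fin k => S.area) =
      (1 / (2 * ballVolume (n - 1))) ^ k *
        ∫ l, lineSum S f l ∂(Measure.pi fun _ : Fin k => kinematicMeasure n) := by
  have hint : Integrable f (Measure.pi fun _ : Fin k => S.area) :=
    hf.integrable_of_hasCompactSupport (HasCompactSupport.of_compactSpace f)
  have hpos : 0 < 2 * ballVolume (n - 1) := mul_pos two_pos (ballVolume_pos _)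
  have hbind := S.bind_intersectionKernel hn
  have hfin : IsFiniteMeasure ((kinematicMeasure n).bind S.intersectionKernel) := by
    rw [hbind]
    exact Measure.smul_finite _ ENNReal.ofReal_ne_top
  -- Each of the `k` factors contributes one constant 2κ_{n-1}.
  have hpi : (Measure.pi fun _ : Fin k => kinematicMeasure n).bind
      (piKernel S.intersectionKernel k) =
        ENNReal.ofReal (2 * ballVolume (n - 1)) ^ k • Measure.pi fun _ : Fin k => S.area := by
    rw [bind_piKernel]
    refine Measure.pi_eq fun s _ => ?_
    rw [hbind, Measure.smul_apply, Measure.pi_pi, smul_eq_mul]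
    simp only [Measure.smul_apply, smul_eq_mul, Finset.prod_mul_distrib, Finset.prod_const,
      Finset.card_univ, Fintype.card_fin]
  have hint' : Integrable f ((Measure.pi fun _ : Fin k => kinematicMeasure n).bind
      (piKernel S.intersectionKernel k)) := by
    rw [hpi]
    exact hint.smul_measure (ENNReal.pow_ne_top ENNReal.ofReal_ne_top)
  obtain ⟨h1, h2⟩ := integral_bind_kernel _ _ hint'
  -- Almost every `k`-tuple consists of good lines, so `lineSum` inherits measurability and
  -- integrability from the kernel integral.
  have hae : (fun l => ∫ x, f x ∂(piKernel S.intersectionKernel k l)) =ᵐ[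
      Measure.pi fun _ : Fin k => kinematicMeasure n] lineSum S f := by
    have hgood : ∀ᵐ l ∂(Measure.pi fun _ : Fin k => kinematicMeasure n),
        ∀ i, l i ∈ S.goodLines := by
      refine ae_all_iff.2 fun i => ?_
      exact Measure.tendsto_eval_ae_ae.eventually (S.ae_mem_goodLines hn)
    filter_upwards [hgood] with l hl using (S.lineSum_eq_integral f hl).symm
  refine ⟨hint, h1.congr hae, ?_⟩
  rw [← integral_congr_ae hae, ← h2, hpi, integral_smul_measure, ENNReal.toReal_pow,
    ENNReal.toReal_ofReal hpos.le, smul_eq_mul, ← mul_assoc, ← mul_pow,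
    one_div_mul_cancel hpos.ne', one_pow, one_mul]
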